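/- For $\lambda=(\lambda_A,\lambda_B,\lambda_C)$ with $\lambda_A,\lambda_B,\lambda_C>0$ and $\lambda_A+\lambda_B+\lambda_C=1$, let $T_\lambda:[0,1)\to[0,1)$ be the symmetric 3-interval exchange transformation with permutation $\begin{pmatrix}A&B&C\\C&B&A\end{pmatrix}$, that is, $$T_\lambda(x)=\begin{cases}x+\lambda_B+\lambda_C,&0\le x<\lambda_A,\\ x+\lambda_C-\lambda_A,&\lambda_A\le x<\lambda_A+\lambda_B,\\ x-\lambda_A-\lambda_B,&\lambda_A+\lambda_B\le x<1.\end{cases}$$ Symmetric 3-IETs are parametrized by the open simplex $\Delta$ of all such $\lambda$, with its Lebesgue measure (in the coordinates $(\lambda_A,\lambda_B)$) and its usual topology. Let $f:[0,1)\to\mathbb{R}$ be of class $C^{1+AC}$, i.e. $f$ is differentiable on $[0,1)$ (one-sidedly at $0$) and $f'$ is absolutely continuous and of bounded variation on $[0,1)$. Suppose that $f(0)=\lim_{x\to1^-}f(x)=0$ and $\int_0^1 f\,dx=0$. Let $T_{\lambda,f}(x,r)=(T_\lambda x,\,r+f(x))$ be the skew product on $[0,1)\times\mathbb{R}$. Then: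 1. For Lebesgue-almost every $\lambda\in\Delta$, $f$ is a coboundary for $T_\lambda$, i.e. there is $g\in L^1([0,1))$ with $f=g\circ T_\lambda-g$ almost everywhere; moreover, $T_{\lambda,f}$ is not ergodic with respect to $\mathrm{Leb}_{[0,1)}\otimes\mathrm{Leb}_{\mathbb{R}}$. 2. If $f$ is not identically $0$, then the set of $\lambda\in\Delta$ for which $T_{\lambda,f}$ is ergodic with respect to $\mathrm{Leb}_{[0,1)}\otimes\mathrm{Leb}_{\mathbb{R}}$ is dense in $\Delta$. -/

import Mathlib

open MeasureTheory

/-- The phase space `[0, 1)`. -/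
abbrev UnitIco : Type := Set.Ico (0 : ℝ) 1

/-- Lebesgue measure on `[0, 1)`. -/
noncomputable def lebUnit : Measure UnitIco := Measure.comap Subtype.val volume

/-- The parameter space of symmetric interval exchanges of three intervals on `[0, 1)`:
positive length vectors `(lA, lB, lC)` with `lA + lB + lC = 1`, in the coordinates `(lA, lB)`.
It carries the subspace topology of the plane. -/
abbrev LengthSimplex : Type :=
  ({p : ℝ × ℝ | 0 < p.1 ∧ 0 < p.2 ∧ p.1 + p.2 < 1} : Set (ℝ × ℝ))

/-- Lebesgue measure on the parameter space. -/
noncomputable def lebSimplex : Measure LengthSimplex := Measure.comap Subtype.val volume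

namespace LengthSimplex

/-- Length of the first interval. -/
def lA (p : LengthSimplex) : ℝ := p.1.1

/-- Length of the second interval. -/
def lB (p : LengthSimplex) : ℝ := p.1.2

/-- Length of the third interval. -/
def lC (p : LengthSimplex) : ℝ := 1 - p.1.1 - p.1.2

end LengthSimplex

/-- The interval exchange of the intervals `[0, lA)`, `[lA, lA + lB)`, `[lA + lB, 1)` with the
permutation `(A B C / C B A)`: each interval is translated, and their images stand in the order
`C, B, A`. -/
noncomputable def symIETFun (p : LengthSimplex) (x : ℝ) : ℝ :=
  if x < p.lA then x + (p.lB + p.lC)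
  else if x < p.lA + p.lB then x + (p.lC - p.lA)
  else x - (p.lA + p.lB)

theorem symIETFun_mem (p : LengthSimplex) {x : ℝ} (hx : x ∈ Set.Ico (0 : ℝ) 1) :
    symIETFun p x ∈ Set.Ico (0 : ℝ) 1 := by
  obtain ⟨ha, hb, hab⟩ := p.2
  obtain ⟨h0, h1⟩ := hx
  unfold symIETFun
  split_ifs <;> simp only [LengthSimplex.lA, LengthSimplex.lB, LengthSimplex.lC] at * <;>
    constructor <;> linarith

/-- The symmetric interval exchange as a self-map of `[0, 1)`. -/
noncomputable def symIET (p : LengthSimplex) (x : UnitIco) : UnitIco :=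
  ⟨symIETFun p x, symIETFun_mem p x.2⟩

/-- `f` is differentiable on `[0, 1)` (from the right at `0`), and its derivative is absolutely
continuous (on every compact subinterval) and of bounded variation on `[0, 1)`. For functions of
bounded variation on `[0, 1)` this is the same as the `ε`-`δ` absolute continuity on `[0, 1)`. -/
def IsC1AC (f : ℝ → ℝ) : Prop :=
  DifferentiableOn ℝ f (Set.Ico 0 1) ∧
  (∀ b ∈ Set.Ico (0 : ℝ) 1,
    AbsolutelyContinuousOnInterval (derivWithin f (Set.Ico 0 1)) 0 b) ∧
  BoundedVariationOn (derivWithin f (Set.Ico 0 1)) (Set.Ico 0 1)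

/-- `f` is a coboundary for `T`: the equation `f = g ∘ T - g` has an integrable solution `g`. -/
def IsCoboundary {X : Type*} [MeasurableSpace X] (μ : Measure X) (T : X → X) (f : X → ℝ) :
    Prop :=
  ∃ g : X → ℝ, Integrable g μ ∧ ∀ᵐ x ∂μ, f x = g (T x) - g x

/-- The skew product `(x, r) ↦ (T x, r + f x)` on `X × ℝ`. -/
def skewProduct {X : Type*} (T : X → X) (f : X → ℝ) (z : X × ℝ) : X × ℝ :=
  (T z.1, z.2 + f z.1)

/-! The exchange is a rotation in disguise. On the circle of length `L = 1 + lB`, rotation by `1 -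
lA` has `symIET` as its first return map to `[0, 1)`: points of the outer intervals return after one
step, points of the middle one after two, passing through the gap `[1, L)`. Extending `f` by zero
over the gap gives a function `F` on the circle (`circleExt`) whose Birkhoff sums over returns are
those of `f`. It is continuous because `f` vanishes at both ends, it has mean zero, and bounded
variation of `f'` gives Fourier coefficients `c n = O(1 / n ^ 2)`.

Coboundaries: divide `c n` by `fourier n θ - 1`. For almost every rotation number the quotients are
square summable, so they define an L² transfer function, which restricts to `[0, 1)`. Its subgraph
is then an invariant set of the skew product, neither null nor conull.

Ergodicity: fix `lB`, hence `L` and `F`, and vary `θ = 1 - lA`. At a rational angle of order `q` the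
sum of `F` along a period retains only the frequencies divisible by `q`. Choose `q` such that `n *
‖c n‖`, for `n ≥ q`, is largest at `q`. Then the frequency `q` controls the whole sum, which lies in
`(0, ε)` on a set of measure bounded below independently of `ε`. Repeating the period brings the sum
close to any prescribed `a > 0`, and this survives small changes of `θ`. Such angles are dense,
since reduced fractions with any given large denominator are. Baire's theorem yields a dense set of
irrational angles with returns for all `a` and `ε`; every `a` is then an essential value of the
cocycle, so the skew product is ergodic.

There are infinitely many usable `q`: otherwise `F` would be a trigonometric polynomial, yet it
vanishes on the gap without vanishing identically. -/

open Filter Topology ENNReal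

/-! ### Skew products over a measure-preserving map -/

section SkewProduct

theorem skewProduct_iterate {X : Type*} (T : X → X) (F : X → ℝ) (n : ℕ) (z : X × ℝ) :
    (skewProduct T F)^[n] z = (T^[n] z.1, z.2 + birkhoffSum T F n z.1) := by
  induction n with
  | zero => simp
  | succ n ih =>
    rw [Function.iterate_succ_apply', ih, Function.iterate_succ_apply', birkhoffSum_succ]
    simp [skewProduct, add_assoc]

theorem measurePreserving_skewProduct {X : Type*} [MeasurableSpace X] {μ : Measure X} [SFinite μ]
    {T : X → X} {F : X → ℝ} (hT : MeasurePreserving T μ μ) (hF : Measurable F) :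
    MeasurePreserving (skewProduct T F) (μ.prod volume) (μ.prod volume) :=
  hT.skew_product (g := fun x r => r + F x) (by fun_prop)
    (Eventually.of_forall fun x => (measurePreserving_add_right volume (F x)).map_eq)

end SkewProduct

/-! ### Essential values: ergodicity from returns -/

section Criterion

theorem ae_add_right_iff {p : ℝ → Prop} (c : ℝ) : (∀ᵐ r, p (r + c)) ↔ ∀ᵐ r, p r := by
  refine ⟨fun h => ?_, fun h => (quasiMeasurePreserving_add_right volume c).ae h⟩
  simpa using (quasiMeasurePreserving_add_right volume (-c)).ae h

theorem iterate_add_right_const {L : ℝ} (θ : AddCircle L) (n : ℕ) (x : AddCircle L) :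
    (· + θ)^[n] x = x + n • θ := by
  simp

variable {L : ℝ} [Fact (0 < L)]

/-- The rotation by `θ` has, on a set of measure at least `c`, return times at which points are
`ε`-close to themselves and the Birkhoff sums of `F` are `ε`-close to `a`, and the resulting
return map is injective. -/
def HasReturns (θ : AddCircle L) (F : AddCircle L → ℝ) (c : ℝ≥0∞) (a ε : ℝ) : Prop :=
  ∃ (W : Set (AddCircle L)) (n : AddCircle L → ℕ), MeasurableSet W ∧ Measurable n ∧
    c ≤ volume W ∧ Set.InjOn (fun x => x + n x • θ) W ∧
    ∀ x ∈ W, dist (x + n x • θ) x ≤ ε ∧ |birkhoffSum (· + θ) F (n x) x - a| ≤ ε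

/-- Cut `W` according to the return time. On each piece the return is a fixed power of a
measure-preserving map, and injectivity on the base makes the images disjoint, so no mass is counted
twice. -/
theorem setLIntegral_return_le {θ : AddCircle L} {F : AddCircle L → ℝ} (hF : Measurable F)
    {W : Set (AddCircle L)} {n : AddCircle L → ℕ} (hW : MeasurableSet W) (hn : Measurable n)
    (hinj : Set.InjOn (fun x => x + n x • θ) W) {g : AddCircle L × ℝ → ℝ≥0∞} (hg : Measurable g) :
    ∫⁻ z in W ×ˢ Set.univ, g ((skewProduct (· + θ) F)^[n z.1] z) ∂(volume.prod volume) ≤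
      ∫⁻ z, g z ∂(volume.prod volume) := by
  set A : ℕ → Set (AddCircle L × ℝ) := fun k => {z | z.1 ∈ W ∧ n z.1 = k} with hA
  set B : ℕ → Set (AddCircle L × ℝ) := fun k => {z | z.1 - k • θ ∈ W ∧ n (z.1 - k • θ) = k}
    with hB
  have hWn : ∀ k, MeasurableSet {x | x ∈ W ∧ n x = k} := fun k =>
    hW.inter (hn (measurableSet_singleton k))
  have hAm : ∀ k, MeasurableSet (A k) := fun k => measurable_fst (hWn k)
  have hBm : ∀ k, MeasurableSet (B k) := fun k =>
    (measurable_fst.sub_const (k • θ)) (hWn k)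
  have hAU : W ×ˢ (Set.univ : Set ℝ) = ⋃ k, A k := by
    ext z; simp [hA]
  have hAd : Pairwise (Function.onFun Disjoint A) := by
    intro i j hij
    rw [Function.onFun, Set.disjoint_left]
    rintro z ⟨-, h1⟩ ⟨-, h2⟩
    exact hij (h1.symm.trans h2)
  have hBd : Pairwise (Function.onFun Disjoint B) := by
    intro i j hij
    rw [Function.onFun, Set.disjoint_left]
    rintro z ⟨h1, h1'⟩ ⟨h2, h2'⟩
    have := hinj h1 h2 (by simp only [h1', h2', sub_add_cancel])
    rw [this, h2'] at h1'
    exact hij h1'.symm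
  have hmp : MeasurePreserving (skewProduct (· + θ) F)
      ((volume : Measure (AddCircle L)).prod (volume : Measure ℝ)) (volume.prod volume) :=
    measurePreserving_skewProduct (measurePreserving_add_right volume θ) hF
  rw [hAU, lintegral_iUnion hAm hAd]
  calc ∑' k, ∫⁻ z in A k, g ((skewProduct (· + θ) F)^[n z.1] z) ∂(volume.prod volume)
      = ∑' k, ∫⁻ z in B k, g z ∂(volume.prod volume) := by
        congr 1; ext k
        rw [← (hmp.iterate k).setLIntegral_comp_preimage (hBm k) hg]
        have : (skewProduct (· + θ) F)^[k] ⁻¹' B k = A k := by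
          ext z
          simp [hA, hB, skewProduct_iterate]
        rw [this]
        refine setLIntegral_congr_fun (hAm k) fun z hz => ?_
        simp only [hz.2]
    _ = ∫⁻ z in ⋃ k, B k, g z ∂(volume.prod volume) := (lintegral_iUnion hBm hBd _).symm
    _ ≤ _ := setLIntegral_le_lintegral _ _

/-- Approximate the indicator of `s` in L¹ by a uniformly continuous `h`. The return sends `z` close
to `z` shifted vertically by `a`, and by invariance keeps its membership in `s`. If the shift
changes membership, the two nearby points have different indicator values but almost equal values of
`h`, so the approximation error is large at one of them. The total error is small, and neither the
shift nor the return map increases it. -/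
theorem exists_forall_return_measure_le {θ : AddCircle L} {F : AddCircle L → ℝ} (hF : Measurable F)
    {s : Set (AddCircle L × ℝ)} (hs : MeasurableSet s) (hinv : skewProduct (· + θ) F ⁻¹' s = s)
    (K a : ℝ) {δ : ℝ≥0∞} (hδ : δ ≠ 0) :
    ∃ ε > 0, ∀ (W : Set (AddCircle L)) (n : AddCircle L → ℕ), MeasurableSet W → Measurable n →
      Set.InjOn (fun x => x + n x • θ) W →
      (∀ x ∈ W, dist (x + n x • θ) x ≤ ε ∧ |birkhoffSum (· + θ) F (n x) x - a| ≤ ε) →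
      (volume.prod volume) ({z : AddCircle L × ℝ | |z.2| ≤ K} ∩ {z | ¬(z ∈ s ↔ (z.1, z.2 + a) ∈ s)} ∩
        W ×ˢ Set.univ) ≤ δ := by
  classical
  set ν : Measure (AddCircle L × ℝ) := volume.prod volume with hν
  -- Truncation makes the indicator integrable. Since `ε ≤ 1`, the window contains both the shift by
  -- `a` and the return of any point of height at most `K`.
  set S : Set (AddCircle L × ℝ) := s ∩ Set.univ ×ˢ Set.Icc (-(K + |a| + 1)) (K + |a| + 1) with hS
  have hSm : MeasurableSet S := hs.inter (MeasurableSet.univ.prod measurableSet_Icc)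
  have hSf : ν S ≠ ∞ := by
    refine ne_top_of_le_ne_top ?_ (measure_mono Set.inter_subset_right)
    rw [hν, Measure.prod_prod]
    exact ENNReal.mul_ne_top (measure_ne_top _ _) measure_Icc_lt_top.ne
  set u : AddCircle L × ℝ → ℝ := S.indicator 1 with hu
  have hui : Integrable u ν := (integrable_indicator_iff hSm).2 (integrableOn_const hSf)
  have hum : Measurable u := measurable_one.indicator hSm
  obtain ⟨h, hhc, hhd, hhcont, -⟩ := hui.exists_hasCompactSupport_lintegral_sub_le
    (ε := δ / 4) (by simp [hδ])
  obtain ⟨η, hη, hηh⟩ := Metric.uniformContinuous_iff.1 (hhc.uniformContinuous_of_continuous hhcont)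
    (1 / 2) (by norm_num)
  refine ⟨min 1 (η / 2), by positivity, fun W n hW hn hinj hWn => ?_⟩
  have hinvn : ∀ k : ℕ, ∀ z, (skewProduct (· + θ) F)^[k] z ∈ s ↔ z ∈ s := by
    intro k z
    have : (skewProduct (· + θ) F)^[k] ⁻¹' s = s := by
      rw [Set.preimage_iterate_eq]; exact Function.iterate_fixed hinv k
    exact Set.ext_iff.1 this z
  set Bad := {z : AddCircle L × ℝ | |z.2| ≤ K} ∩ {z | ¬(z ∈ s ↔ (z.1, z.2 + a) ∈ s)} ∩
    W ×ˢ Set.univ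
  set g : AddCircle L × ℝ → ℝ≥0∞ := fun z => ‖u z - h z‖ₑ with hg
  have hgm : Measurable g := (hum.sub hhcont.measurable).enorm
  have hpt : ∀ z ∈ Bad, (1 : ℝ≥0∞) ≤
      2 * (g (z.1, z.2 + a) + g ((skewProduct (· + θ) F)^[n z.1] z)) := by
    rintro z ⟨⟨hzK, hzs⟩, hzW, -⟩
    obtain ⟨h1, h2⟩ := hWn _ hzW
    set w := (skewProduct (· + θ) F)^[n z.1] z with hw
    have hw' : w = (z.1 + n z.1 • θ, z.2 + birkhoffSum (· + θ) F (n z.1) z.1) := by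
      rw [hw, skewProduct_iterate, iterate_add_right_const]
    have hws : w ∈ s ↔ z ∈ s := hinvn _ z
    have ha := abs_le.1 (le_refl |a|)
    have hK := abs_le.1 (show |z.2| ≤ K from hzK)
    have h2' := abs_le.1 (h2.trans (min_le_left _ _))
    have huz : u (z.1, z.2 + a) = if (z.1, z.2 + a) ∈ s then 1 else 0 := by
      have : (z.1, z.2 + a) ∈ S ↔ (z.1, z.2 + a) ∈ s := by
        simp only [hS, Set.mem_inter_iff, Set.mem_prod, Set.mem_univ, true_and, Set.mem_Icc,
          and_iff_left_iff_imp]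
        intro _; constructor <;> linarith
      simp only [hu, Set.indicator_apply, this, Pi.one_apply]
    have huw : u w = if z ∈ s then 1 else 0 := by
      have : w ∈ S ↔ z ∈ s := by
        rw [← hws]
        simp only [hS, Set.mem_inter_iff, Set.mem_prod, Set.mem_univ, true_and, Set.mem_Icc,
          and_iff_left_iff_imp]
        intro _; rw [hw']; constructor <;> simp only <;> linarith
      simp only [hu, Set.indicator_apply, this, Pi.one_apply]
    have hdist : dist (z.1, z.2 + a) w < η := by
      rw [hw', Prod.dist_eq, max_lt_iff]
      constructor
      · rw [dist_comm]
        exact (h1.trans (min_le_right _ _)).trans_lt (by linarith)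
      · simp only [Real.dist_eq]
        rw [abs_sub_comm, show z.2 + birkhoffSum (· + θ) F (n z.1) z.1 - (z.2 + a) =
          birkhoffSum (· + θ) F (n z.1) z.1 - a by ring]
        exact (h2.trans (min_le_right _ _)).trans_lt (by linarith)
    have hh := hηh hdist
    rw [Real.dist_eq] at hh
    have hone : |u (z.1, z.2 + a) - u w| = 1 := by
      replace hzs : ¬(z ∈ s ↔ (z.1, z.2 + a) ∈ s) := hzs
      rw [huz, huw]
      by_cases hz1 : z ∈ s <;> by_cases hz2 : (z.1, z.2 + a) ∈ s <;>
        simp only [hz1, hz2, if_true, if_false, iff_true, iff_false, not_true] at hzs ⊢ <;> norm_num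
    have key : 1 ≤ 2 * (|u (z.1, z.2 + a) - h (z.1, z.2 + a)| + |u w - h w|) := by
      have e1 := abs_add_le (u (z.1, z.2 + a) - h (z.1, z.2 + a))
        ((h (z.1, z.2 + a) - h w) + (h w - u w))
      have e2 := abs_add_le (h (z.1, z.2 + a) - h w) (h w - u w)
      rw [show (u (z.1, z.2 + a) - h (z.1, z.2 + a)) + ((h (z.1, z.2 + a) - h w) + (h w - u w)) =
        u (z.1, z.2 + a) - u w by ring] at e1
      rw [abs_sub_comm (h w)] at e2
      linarith
    simp only [hg, Real.enorm_eq_ofReal_abs]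
    rw [← ENNReal.ofReal_add (abs_nonneg _) (abs_nonneg _), ← ENNReal.ofReal_ofNat,
      ← ENNReal.ofReal_mul (by norm_num), ← ENNReal.ofReal_one]
    exact ENNReal.ofReal_le_ofReal key
  have hsm : Measurable fun z : AddCircle L × ℝ => (z.1, z.2 + a) := by fun_prop
  have hBadm : MeasurableSet Bad := by
    refine MeasurableSet.inter ?_ (hW.prod MeasurableSet.univ)
    exact (measurableSet_le (measurable_norm.comp measurable_snd) measurable_const).inter
      (MeasurableSet.compl (MeasurableSet.iff hs (hsm hs)))
  have htr : MeasurePreserving (fun z : AddCircle L × ℝ => (z.1, z.2 + a)) ν ν :=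
    (MeasurePreserving.id _).prod (measurePreserving_add_right volume a)
  calc ν Bad = ∫⁻ z in Bad, 1 ∂ν := by simp
    _ ≤ ∫⁻ z in Bad, 2 * (g (z.1, z.2 + a) + g ((skewProduct (· + θ) F)^[n z.1] z)) ∂ν :=
        setLIntegral_mono' hBadm hpt
    _ = 2 * (∫⁻ z in Bad, g (z.1, z.2 + a) ∂ν +
          ∫⁻ z in Bad, g ((skewProduct (· + θ) F)^[n z.1] z) ∂ν) := by
        rw [lintegral_const_mul' _ _ (by simp)]
        exact congrArg _ (lintegral_add_left (hgm.comp hsm) _)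
    _ ≤ 2 * (∫⁻ z, g (z.1, z.2 + a) ∂ν +
          ∫⁻ z in W ×ˢ Set.univ, g ((skewProduct (· + θ) F)^[n z.1] z) ∂ν) := by
        gcongr 2 * (?_ + ?_)
        · exact setLIntegral_le_lintegral _ _
        · exact lintegral_mono_set Set.inter_subset_right
    _ ≤ 2 * (∫⁻ z, g z ∂ν + ∫⁻ z, g z ∂ν) := by
        gcongr 2 * (?_ + ?_)
        · exact (htr.lintegral_comp hgm).le
        · exact setLIntegral_return_le hF hW hn hinj hgm
    _ ≤ 2 * (δ / 4 + δ / 4) := by gcongr 2 * (?_ + ?_)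
    _ = δ := by
        rw [← ENNReal.add_div, ← two_mul, ← mul_div_assoc, ← mul_assoc]
        norm_num
        rw [mul_comm, ENNReal.mul_div_cancel_right (by norm_num) (by norm_num)]

/-- The fibres unchanged by the shift by `a` form a rotation-invariant set of base points, so
positive measure is enough. The set contains a decreasing intersection of sets `A k`, each of
measure at least `c / 2`; it matters here that `c` does not depend on `ε`. -/
theorem ae_ae_mem_iff_of_hasReturns {θ : AddCircle L} {F : AddCircle L → ℝ} (hF : Measurable F)
    (hθ : Ergodic (· + θ) (volume : Measure (AddCircle L))) {c : ℝ≥0∞} (hc : c ≠ 0) {a : ℝ}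
    (hret : ∀ ε > 0, HasReturns θ F c a ε)
    {s : Set (AddCircle L × ℝ)} (hs : MeasurableSet s) (hinv : skewProduct (· + θ) F ⁻¹' s = s) :
    ∀ᵐ x : AddCircle L, ∀ᵐ r : ℝ, ((x, r) ∈ s ↔ (x, r + a) ∈ s) := by
  have hsm : Measurable fun z : AddCircle L × ℝ => (z.1, z.2 + a) := by fun_prop
  have hB : MeasurableSet {z : AddCircle L × ℝ | ¬(z ∈ s ↔ (z.1, z.2 + a) ∈ s)} :=
    MeasurableSet.compl (MeasurableSet.iff hs (hsm hs))
  set B : ℕ → Set (AddCircle L × ℝ) := fun k =>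
    {z | |z.2| ≤ k} ∩ {z | ¬(z ∈ s ↔ (z.1, z.2 + a) ∈ s)} with hBdef
  have hBm : ∀ k, MeasurableSet (B k) := fun k =>
    (measurableSet_le (measurable_norm.comp measurable_snd) measurable_const).inter hB
  set D : ℕ → AddCircle L → ℝ≥0∞ := fun k x => volume (Prod.mk x ⁻¹' B k) with hD
  have hDm : ∀ k, Measurable (D k) := fun k => measurable_measure_prodMk_left (hBm k)
  set A : ℕ → Set (AddCircle L) := fun k => {x | D k x ≤ (k : ℝ≥0∞)⁻¹} with hA
  have hAm : ∀ k, MeasurableSet (A k) := fun k => measurableSet_le (hDm k) measurable_const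
  have hDmono : ∀ {i j : ℕ}, i ≤ j → ∀ x, D i x ≤ D j x := by
    intro i j hij x
    refine measure_mono fun r hr => ⟨?_, hr.2⟩
    have h1 : |r| ≤ i := hr.1
    have h2 : |r| ≤ j := h1.trans (by exact_mod_cast hij)
    exact h2
  have hAanti : Antitone A := by
    intro i j hij x hx
    exact (hDmono hij x).trans (le_trans hx (by gcongr))
  have hAc : ∀ k, c / 2 ≤ volume (A k) := by
    intro k
    rcases Nat.eq_zero_or_pos k with rfl | hk
    -- The inverse of `0` is `∞`, so the condition defining `A 0` is empty.
    · have h0 : A 0 = Set.univ := by ext x; simp [hA]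
      obtain ⟨W, n, -, -, hcW, -⟩ := hret 1 one_pos
      rw [h0]
      exact ENNReal.half_le_self.trans (hcW.trans (measure_mono (Set.subset_univ _)))
    have hk0 : (k : ℝ≥0∞) ≠ 0 := by exact_mod_cast hk.ne'
    have hctop : c ≠ ∞ := by
      obtain ⟨W, n, -, -, hcW, -⟩ := hret 1 one_pos
      exact ne_top_of_le_ne_top (measure_ne_top _ _) hcW
    obtain ⟨ε, hε, hεW⟩ := exists_forall_return_measure_le hF hs hinv k a
      (δ := (k : ℝ≥0∞)⁻¹ * (c / 2)) (mul_ne_zero (by simp) (by simp [hc]))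
    obtain ⟨W, n, hW, hn, hcW, hinj, hWn⟩ := hret ε hε
    have h1 := hεW W n hW hn hinj hWn
    -- Markov's inequality for the fibre measures of the bad set.
    have h2 : volume (W \ A k) ≤ c / 2 := by
      have h3 : (k : ℝ≥0∞)⁻¹ * volume (W \ A k) ≤ (k : ℝ≥0∞)⁻¹ * (c / 2) := by
        calc (k : ℝ≥0∞)⁻¹ * volume (W \ A k) = ∫⁻ x in W \ A k, (k : ℝ≥0∞)⁻¹ := by simp
          _ ≤ ∫⁻ x in W \ A k, D k x :=
              setLIntegral_mono' (hW.diff (hAm k)) fun x hx => (not_le.1 hx.2).le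
          _ ≤ ∫⁻ x in W, D k x := lintegral_mono_set Set.sdiff_subset
          _ = (volume.prod volume) (B k ∩ W ×ˢ Set.univ) := by
              rw [Measure.prod_apply ((hBm k).inter (hW.prod MeasurableSet.univ)),
                ← lintegral_indicator hW]
              congr 1; ext x
              by_cases hx : x ∈ W
              · simp [hD, Set.preimage_inter, hx]
              · simp [Set.preimage_inter, hx]
          _ ≤ _ := h1
      exact (ENNReal.mul_le_mul_iff_right (by simp) (by simp [hk.ne'])).1 h3
    have h4 : c ≤ volume (A k) + c / 2 := by
      calc c ≤ volume W := hcW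
        _ ≤ volume (A k ∪ W \ A k) := measure_mono fun x hx => by
            by_cases h : x ∈ A k
            · exact Or.inl h
            · exact Or.inr ⟨hx, h⟩
        _ ≤ volume (A k) + volume (W \ A k) := measure_union_le _ _
        _ ≤ _ := by gcongr
    calc c / 2 = c - c / 2 := (ENNReal.sub_half hctop).symm
      _ ≤ volume (A k) := tsub_le_iff_right.2 h4
  have hI : c / 2 ≤ volume (⋂ k, A k) :=
    ge_of_tendsto' (tendsto_measure_iInter_atTop (fun k => (hAm k).nullMeasurableSet) hAanti
      ⟨0, measure_ne_top _ _⟩) hAc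
  set E : Set (AddCircle L) := {x | ∀ᵐ r : ℝ, ((x, r) ∈ s ↔ (x, r + a) ∈ s)} with hE
  have hEm : MeasurableSet E := by
    have : E = {x | volume (Prod.mk x ⁻¹' {z : AddCircle L × ℝ | ¬(z ∈ s ↔ (z.1, z.2 + a) ∈ s)})
        = 0} := rfl
    rw [this]
    exact measurable_measure_prodMk_left hB (measurableSet_singleton 0)
  have hIE : (⋂ k, A k) ⊆ E := by
    intro x hx
    have h0 : ∀ k, D k x = 0 := by
      intro k
      refine le_antisymm (ge_of_tendsto ENNReal.tendsto_inv_nat_nhds_zero ?_) bot_le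
      filter_upwards [eventually_ge_atTop k] with j hj
      exact (hDmono hj x).trans (Set.mem_iInter.1 hx j)
    have : ∀ᵐ r : ℝ, ∀ k : ℕ, ¬ (x, r) ∈ B k := ae_all_iff.2 fun k =>
      measure_eq_zero_iff_ae_notMem.1 (h0 k)
    filter_upwards [this] with r hr
    obtain ⟨k, hk⟩ := exists_nat_ge |r|
    by_contra hcon
    exact hr k ⟨hk, hcon⟩
  have hEinv : (· + θ) ⁻¹' E = E := by
    ext x
    have hs' : ∀ r, (x + θ, r + F x) ∈ s ↔ (x, r) ∈ s := fun r => Set.ext_iff.1 hinv (x, r)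
    simp only [hE, Set.mem_preimage, Set.mem_ofPred_eq]
    rw [← ae_add_right_iff (F x)]
    simp only [hs', add_right_comm _ (F x) a]
  rcases hθ.toPreErgodic.measure_self_or_compl_eq_zero hEm hEinv with h | h
  · exact absurd (le_antisymm (hI.trans ((measure_mono hIE).trans h.le)) bot_le) (by simp [hc])
  · exact h

/-- If for all positive `a` the cocycle `F` over an ergodic rotation has returns with Birkhoff
sums close to `a`, then the skew product is ergodic. -/
theorem ergodic_skewProduct_of_hasReturns {θ : AddCircle L} {F : AddCircle L → ℝ}
    (hF : Measurable F) (hθ : Ergodic (· + θ) (volume : Measure (AddCircle L))) {c : ℝ≥0∞}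
    (hc : c ≠ 0) (hret : ∀ a > 0, ∀ ε > 0, HasReturns θ F c a ε) :
    Ergodic (skewProduct (· + θ) F) ((volume : Measure (AddCircle L)).prod volume) := by
  refine ⟨measurePreserving_skewProduct hθ.toMeasurePreserving hF, ⟨fun s hs hinv => ?_⟩⟩
  have hpos : ∀ a > 0, ∀ᵐ x : AddCircle L, ∀ᵐ r : ℝ, ((x, r) ∈ s ↔ (x, r + a) ∈ s) :=
    fun a ha => ae_ae_mem_iff_of_hasReturns hF hθ hc (hret a ha) hs hinv
  -- Negative shifts come from positive ones by translating the fibre.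
  have hall : ∀ a : ℝ, ∀ᵐ x : AddCircle L, ∀ᵐ r : ℝ, ((x, r) ∈ s → (x, r + a) ∈ s) := by
    intro a
    rcases lt_trichotomy a 0 with ha | rfl | ha
    · filter_upwards [hpos (-a) (by linarith)] with x hx
      filter_upwards [(quasiMeasurePreserving_add_right volume a).ae hx] with r hr
      rw [add_neg_cancel_right] at hr
      exact hr.2
    · simp
    · filter_upwards [hpos a ha] with x hx
      filter_upwards [hx] with r hr using hr.1
  have hm : MeasurableSet {q : AddCircle L × ℝ × ℝ |
      (q.1, q.2.2) ∈ s → (q.1, q.2.2 + q.2.1) ∈ s} := by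
    have h1 : Measurable fun q : AddCircle L × ℝ × ℝ => (q.1, q.2.2) := by fun_prop
    have h2 : Measurable fun q : AddCircle L × ℝ × ℝ => (q.1, q.2.2 + q.2.1) := by fun_prop
    exact MeasurableSet.imp (h1 hs) (h2 hs)
  have hswap : ∀ᵐ x : AddCircle L, ∀ᵐ a : ℝ, ∀ᵐ r : ℝ, ((x, r) ∈ s → (x, r + a) ∈ s) := by
    rw [Measure.ae_ae_comm]
    · exact Eventually.of_forall hall
    · have : MeasurableSet {q : (AddCircle L × ℝ) × ℝ |
          (q.1.1, q.2) ∈ s → (q.1.1, q.2 + q.1.2) ∈ s} :=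
        (show Measurable fun q : (AddCircle L × ℝ) × ℝ => (q.1.1, q.1.2, q.2) by fun_prop) hm
      exact measurable_measure_prodMk_left this.compl (measurableSet_singleton 0)
  have hfib : ∀ᵐ x : AddCircle L, (∀ᵐ r : ℝ, (x, r) ∉ s) ∨ ∀ᵐ r : ℝ, (x, r) ∈ s := by
    filter_upwards [hswap] with x hx
    by_cases h0 : ∀ᵐ r : ℝ, (x, r) ∉ s
    · exact Or.inl h0
    right
    have hmx : MeasurableSet {q : ℝ × ℝ | (x, q.2) ∈ s → (x, q.2 + q.1) ∈ s} :=
      measurable_prodMk_left hm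
    have hx' := (Measure.ae_ae_comm (p := fun a r => (x, r) ∈ s → (x, r + a) ∈ s) hmx).1 hx
    -- A fibre that is not null contains an `r` for which almost every translate `r + a` is again in
    -- the fibre; hence the fibre is conull.
    obtain ⟨r, hr1, hr2⟩ := (Filter.Frequently.and_eventually h0 hx').exists
    rw [← ae_add_right_iff r]
    filter_upwards [hr2] with a ha
    rw [add_comm]
    exact ha hr1
  set E : Set (AddCircle L) := {x | ∀ᵐ r : ℝ, (x, r) ∈ s} with hE
  have hEm : MeasurableSet E := by
    have : E = {x | volume (Prod.mk x ⁻¹' sᶜ) = 0} := rfl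
    rw [this]
    exact measurable_measure_prodMk_left hs.compl (measurableSet_singleton 0)
  have hEinv : (· + θ) ⁻¹' E = E := by
    ext x
    have hs' : ∀ r, (x + θ, r + F x) ∈ s ↔ (x, r) ∈ s := fun r => Set.ext_iff.1 hinv (x, r)
    simp only [hE, Set.mem_preimage, Set.mem_ofPred_eq]
    rw [← ae_add_right_iff (F x)]
    simp only [hs']
  rw [eventuallyConst_set]
  rcases hθ.toPreErgodic.measure_self_or_compl_eq_zero hEm hEinv with h | h
  · right
    rw [Measure.ae_prod_iff_ae_ae hs.compl]
    filter_upwards [hfib, measure_eq_zero_iff_ae_notMem.1 h] with x hx1 hx2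
    exact hx1.resolve_right hx2
  · left
    refine (Measure.ae_prod_mem_iff_ae_ae_mem hs).2 ?_
    exact h

end Criterion

/-! ### Returns for rotations close to a periodic one -/

section NearPeriodic

theorem birkhoffSum_add_right_apply {L : ℝ} (θ : AddCircle L) (F : AddCircle L → ℝ) (n : ℕ)
    (x : AddCircle L) :
    birkhoffSum (· + θ) F n x = ∑ k ∈ Finset.range n, F (x + k • θ) := by
  simp [birkhoffSum]

theorem birkhoffSum_mul_of_nsmul_eq_zero {L : ℝ} {θ : AddCircle L} {q : ℕ} (hq : q • θ = 0)
    (F : AddCircle L → ℝ) (m : ℕ) (x : AddCircle L) :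
    birkhoffSum (· + θ) F (m * q) x = m * birkhoffSum (· + θ) F q x := by
  induction m with
  | zero => simp
  | succ m ih =>
    have h : (m * q) • θ = 0 := by rw [mul_smul, hq, smul_zero]
    rw [add_mul, one_mul, birkhoffSum_add, ih, iterate_add_right_const, h, add_zero]
    push_cast; ring

theorem continuous_birkhoffSum_add_right {L : ℝ} {F : AddCircle L → ℝ} (hF : Continuous F)
    (n : ℕ) : Continuous fun z : AddCircle L × AddCircle L => birkhoffSum (· + z.1) F n z.2 := by
  simp only [birkhoffSum_add_right_apply]
  fun_prop

variable {L : ℝ} [Fact (0 < L)]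

/-- At `θ₀` itself, after `m` periods every point is back and the sum is `m * Φ x`, so small
positive `Φ x` allows `a` to be hit within `ε`. The number of periods depends on `x`; finitely many
compact pieces on which it is constant carry almost half of the measure, and over compact sets the
required strict conditions are open in `θ`. -/
theorem eventually_hasReturns_of_nsmul_eq_zero {F : AddCircle L → ℝ} (hF : Continuous F)
    {θ₀ : AddCircle L} {q : ℕ} (hq : q • θ₀ = 0) {a ε : ℝ} (ha : 0 < a) (hε : 0 < ε) {c : ℝ≥0∞}
    (hc : c < volume {x | 0 < birkhoffSum (· + θ₀) F q x ∧ birkhoffSum (· + θ₀) F q x < ε} / 2) :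
    ∀ᶠ θ in 𝓝 θ₀, HasReturns θ F c a ε := by
  set Φ : AddCircle L → ℝ := birkhoffSum (· + θ₀) F q with hΦ
  have hΦc : Continuous Φ := (continuous_birkhoffSum_add_right hF q).comp
    (show Continuous fun x : AddCircle L => (θ₀, x) by fun_prop)
  -- With this choice `a < m x * Φ x ≤ a + Φ x`, which is below `a + ε`.
  set m : AddCircle L → ℕ := fun x => ⌊a / Φ x⌋₊ + 1 with hm
  have hmm : Measurable m := ((measurable_const.div hΦc.measurable).nat_floor).add_const 1
  set U : ℕ → Set (AddCircle L) := fun k => {x | 0 < Φ x ∧ Φ x < ε} ∩ m ⁻¹' {k} with hU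
  have hO : MeasurableSet {x | 0 < Φ x ∧ Φ x < ε} :=
    (measurableSet_lt measurable_const hΦc.measurable).inter
      (measurableSet_lt hΦc.measurable measurable_const)
  have hUm : ∀ k, MeasurableSet (U k) := fun k => hO.inter (hmm (measurableSet_singleton k))
  have hUsum : volume {x | 0 < Φ x ∧ Φ x < ε} = ∑' k, volume (U k) := by
    rw [← measure_iUnion _ hUm, ← Set.inter_iUnion, ← Set.preimage_iUnion]
    · congr 1; ext x; simp
    · intro i j hij
      rw [Function.onFun, Set.disjoint_left]
      rintro x ⟨-, h1⟩ ⟨-, h2⟩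
      exact hij ((show m x = i from h1).symm.trans h2)
  have hK : ∀ k, ∃ K ⊆ U k, IsCompact K ∧ volume (U k) / 2 ≤ volume K := by
    intro k
    rcases eq_or_ne (volume (U k)) 0 with h0 | h0
    · exact ⟨∅, Set.empty_subset _, isCompact_empty, by simp [h0]⟩
    · obtain ⟨K, hKU, hKc, hlt⟩ := (hUm k).exists_lt_isCompact
        (ENNReal.half_lt_self h0 (measure_ne_top _ _))
      exact ⟨K, hKU, hKc, hlt.le⟩
  choose K hKU hKc hKv using hK
  obtain ⟨M, hM⟩ : ∃ M, c < ∑ k ∈ Finset.range M, volume (K k) := by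
    rw [← lt_iSup_iff, ← ENNReal.tsum_eq_iSup_nat]
    refine hc.trans_le ?_
    rw [hUsum, div_eq_mul_inv, ← ENNReal.tsum_mul_right]
    exact ENNReal.tsum_le_tsum fun k => by simpa [div_eq_mul_inv] using hKv k
  have hKd : ∀ i j, i ≠ j → Disjoint (K i) (K j) := by
    intro i j hij
    rw [Set.disjoint_left]
    intro x h1 h2
    exact hij ((show m x = i from (hKU i h1).2).symm.trans (hKU j h2).2)
  have hsum : ∀ k x, x ∈ K k → |birkhoffSum (· + θ₀) F (k * q) x - a| < ε := by
    intro k x hx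
    obtain ⟨⟨h1, h2⟩, h3⟩ := hKU k hx
    rw [birkhoffSum_mul_of_nsmul_eq_zero hq]
    rw [show k = ⌊a / Φ x⌋₊ + 1 from (show m x = k from h3).symm]
    have e1 := Nat.floor_le (div_nonneg ha.le h1.le)
    have e2 := Nat.lt_floor_add_one (a / Φ x)
    rw [le_div_iff₀ h1] at e1
    rw [div_lt_iff₀ h1] at e2
    rw [abs_lt]
    push_cast
    constructor <;> nlinarith
  have ev1 : ∀ k ∈ Finset.range M, ∀ᶠ θ in 𝓝 θ₀, ∀ x ∈ K k,
      dist (x + (k * q) • θ) x ≤ ε ∧ |birkhoffSum (· + θ) F (k * q) x - a| ≤ ε := by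
    intro k _
    refine (hKc k).eventually_forall_of_forall_eventually fun x hx => ?_
    have c1 : Continuous fun z : AddCircle L × AddCircle L => dist (z.2 + (k * q) • z.1) z.2 := by
      fun_prop
    have c2 : Continuous fun z : AddCircle L × AddCircle L =>
        |birkhoffSum (· + z.1) F (k * q) z.2 - a| :=
      ((continuous_birkhoffSum_add_right hF _).sub continuous_const).abs
    have h1 : dist (x + (k * q) • θ₀) x < ε := by
      rw [mul_smul, hq]; simpa using hε
    filter_upwards [(c1.tendsto (θ₀, x)).eventually (gt_mem_nhds h1),
      (c2.tendsto (θ₀, x)).eventually (gt_mem_nhds (hsum k x hx))] with z hz1 hz2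
    exact ⟨hz1.le, hz2.le⟩
  -- Injectivity of the return map: at `θ₀` the pieces return to themselves and are disjoint compact
  -- sets, so their images stay disjoint for nearby `θ`.
  have ev2 : ∀ i ∈ Finset.range M, ∀ j ∈ Finset.range M, i ≠ j → ∀ᶠ θ in 𝓝 θ₀,
      ∀ p ∈ K i ×ˢ K j, p.1 + (i * q) • θ ≠ p.2 + (j * q) • θ := by
    intro i _ j _ hij
    refine ((hKc i).prod (hKc j)).eventually_forall_of_forall_eventually fun p hp => ?_
    have hne : p.1 + (i * q) • θ₀ ≠ p.2 + (j * q) • θ₀ := by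
      rw [mul_smul, mul_smul, hq, smul_zero, smul_zero, add_zero, add_zero]
      rintro h
      exact Set.disjoint_left.1 (hKd i j hij) hp.1 (h ▸ hp.2)
    have c1 : Continuous fun z : AddCircle L × (AddCircle L × AddCircle L) =>
        z.2.1 + (i * q) • z.1 := by fun_prop
    have c2 : Continuous fun z : AddCircle L × (AddCircle L × AddCircle L) =>
        z.2.2 + (j * q) • z.1 := by fun_prop
    exact (isOpen_ne_fun c1 c2).mem_nhds hne
  have ev2' : ∀ᶠ θ in 𝓝 θ₀, ∀ i ∈ Finset.range M, ∀ j ∈ Finset.range M, i ≠ j →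
      ∀ p ∈ K i ×ˢ K j, p.1 + (i * q) • θ ≠ p.2 + (j * q) • θ := by
    simp only [eventually_all_finset, eventually_all]
    exact ev2
  filter_upwards [(eventually_all_finset _).2 ev1, ev2'] with θ h1 h2
  have hKn : ∀ k x, x ∈ K k → m x = k := fun k x hx => (hKU k hx).2
  refine ⟨⋃ k ∈ Finset.range M, K k, fun x => m x * q,
    Finset.measurableSet_biUnion _ fun k _ => (hKc k).measurableSet, hmm.mul_const q, ?_, ?_, ?_⟩
  · rw [measure_biUnion_finset (fun i _ j _ hij => hKd i j hij) fun k _ => (hKc k).measurableSet]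
    exact hM.le
  · intro x hx y hy hxy
    simp only [Set.mem_iUnion] at hx hy
    obtain ⟨i, hi, hxi⟩ := hx
    obtain ⟨j, hj, hyj⟩ := hy
    simp only [hKn i x hxi, hKn j y hyj] at hxy
    by_cases hij : i = j
    · subst hij; exact add_right_cancel hxy
    · exact absurd hxy (h2 i hi j hj hij (x, y) ⟨hxi, hyj⟩)
  · intro x hx
    simp only [Set.mem_iUnion] at hx
    obtain ⟨i, hi, hxi⟩ := hx
    simp only [hKn i x hxi]
    exact h1 i hi x hxi

end NearPeriodic

open AddCircle ComplexConjugate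

/-! ### Fourier analysis of the Birkhoff sum over one period -/

section Fourier

variable {L : ℝ} [Fact (0 < L)]

theorem fourierCoeff_comp_add_right (f : AddCircle L → ℂ) (θ : AddCircle L) (n : ℤ) :
    fourierCoeff (fun x => f (x + θ)) n = fourier n θ * fourierCoeff f n := by
  unfold fourierCoeff
  rw [← integral_const_mul,
    ← integral_add_right_eq_self (μ := haarAddCircle) (fun t => fourier n θ * (fourier (-n) t • f t)) θ]
  congr 1; ext t
  have h : fourier (-n) (t + θ) = fourier (-n) t * fourier (-n) θ := by
    simp [fourier_apply, smul_add, toCircle_add]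
  have h' : fourier n θ * fourier (-n) θ = (1 : ℂ) := by
    rw [← fourier_add]; simp
  rw [h, smul_eq_mul, smul_eq_mul]
  linear_combination -(fourier (-n) t * f (t + θ)) * h'

theorem fourierCoeff_ofReal_neg (F : AddCircle L → ℝ) (n : ℤ) :
    fourierCoeff (fun x => (F x : ℂ)) (-n) = conj (fourierCoeff (fun x => (F x : ℂ)) n) := by
  unfold fourierCoeff
  rw [← integral_conj]
  congr 1; ext t
  simp

theorem integrable_of_continuous {E : Type*} [NormedAddCommGroup E]
    {f : AddCircle L → E} (hf : Continuous f) :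
    Integrable f haarAddCircle :=
  integrableOn_univ.1 (hf.continuousOn.integrableOn_compact isCompact_univ)

/-- Translation multiplies the coefficient by `fourier n θ`, a root of unity of order dividing `q`;
the resulting geometric sum is `q` or `0`. -/
theorem fourierCoeff_birkhoffSum {F : AddCircle L → ℝ} (hF : Continuous F) {θ : AddCircle L}
    {q : ℕ} (hq : addOrderOf θ = q) (n : ℤ) :
    fourierCoeff (fun x => ((birkhoffSum (· + θ) F q x : ℝ) : ℂ)) n =
      if (q : ℤ) ∣ n then q * fourierCoeff (fun x => (F x : ℂ)) n else 0 := by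
  have h1 : (fun x => ((birkhoffSum (· + θ) F q x : ℝ) : ℂ)) =
      ∑ k ∈ Finset.range q, fun x => (F (x + k • θ) : ℂ) := by
    ext x; simp [birkhoffSum_add_right_apply]
  rw [h1, fourierCoeff.sum]
  swap
  · intro k _; exact integrable_of_continuous (by fun_prop)
  simp only [Finset.sum_apply, fourierCoeff_comp_add_right (fun x => (F x : ℂ))]
  rw [← Finset.sum_mul]
  have h2 : ∀ k : ℕ, (fourier n (k • θ) : ℂ) = (fourier n θ) ^ k := by
    intro k
    simp only [fourier_apply]
    rw [smul_comm, toCircle_nsmul, Circle.coe_pow]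
  simp only [h2]
  split_ifs with hd
  · have : (fourier n θ : ℂ) = 1 := by
      have : n • θ = 0 := by rw [← hq] at hd; exact addOrderOf_dvd_iff_zsmul_eq_zero.1 hd
      rw [fourier_apply, this]; simp
    simp [this]
  · have hz : (fourier n θ : ℂ) ≠ 1 := by
      intro h
      apply hd
      rw [← hq, addOrderOf_dvd_iff_zsmul_eq_zero]
      refine injective_toCircle (Fact.out : 0 < L).ne' ?_
      rw [toCircle_zero]
      exact Circle.ext h
    rw [geom_sum_eq hz, ← h2, ← hq, addOrderOf_nsmul_eq_zero]
    simp

theorem hasSum_sq_norm_fourierCoeff_of_continuous {f : AddCircle L → ℂ} (hf : Continuous f) :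
    HasSum (fun n => ‖fourierCoeff f n‖ ^ 2) (∫ x, ‖f x‖ ^ 2 ∂haarAddCircle) := by
  have h := hasSum_sq_fourierCoeff
    (ContinuousMap.toLp (E := ℂ) 2 haarAddCircle ℂ (⟨f, hf⟩ : C(AddCircle L, ℂ)))
  simp only [fourierCoeff_toLp] at h
  suffices e : ∫ x, ‖f x‖ ^ 2 ∂haarAddCircle = ∫ x, ‖(ContinuousMap.toLp (E := ℂ) 2 haarAddCircle ℂ
      (⟨f, hf⟩ : C(AddCircle L, ℂ)) : AddCircle L → ℂ) x‖ ^ 2 ∂haarAddCircle by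
    rw [e]; exact h
  refine integral_congr_ae ?_
  filter_upwards [ContinuousMap.coeFn_toLp (E := ℂ) (p := 2) (𝕜 := ℂ) haarAddCircle
    (⟨f, hf⟩ : C(AddCircle L, ℂ))] with x hx
  rw [hx]; rfl

theorem summable_int_one_div_sq : Summable fun k : ℤ => 1 / (k : ℝ) ^ 2 :=
  Real.summable_one_div_int_pow.2 one_lt_two

theorem tsum_int_one_div_sq_le : ∑' k : ℤ, 1 / (k : ℝ) ^ 2 ≤ 4 := by
  have h := HasSum.of_nat_of_neg (f := fun k : ℤ => 1 / (k : ℝ) ^ 2)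
    (by simpa using hasSum_zeta_two) (by simpa using hasSum_zeta_two)
  rw [h.tsum_eq]
  have := Real.pi_lt_d2
  have := Real.pi_pos
  simp
  nlinarith

/-- Parseval over the multiples `k * q`, with `hrec` bounding the coefficient there by a multiple `1
/ k` of the one at `q`. The term `k = 0` vanishes on both sides, since `1 / 0 = 0`. -/
theorem integral_birkhoffSum_sq_le {F : AddCircle L → ℝ} (hF : Continuous F) {θ : AddCircle L}
    {q : ℕ} (hq : addOrderOf θ = q) (hq0 : q ≠ 0)
    (h0 : fourierCoeff (fun x => (F x : ℂ)) 0 = 0)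
    (hrec : ∀ k : ℕ, k ≠ 0 → k * ‖fourierCoeff (fun x => (F x : ℂ)) (k * q : ℕ)‖ ≤
      ‖fourierCoeff (fun x => (F x : ℂ)) q‖) :
    ∫ x, (birkhoffSum (· + θ) F q x) ^ 2 ∂haarAddCircle ≤
      4 * (q * ‖fourierCoeff (fun x => (F x : ℂ)) q‖) ^ 2 := by
  set c := fourierCoeff (fun x => (F x : ℂ)) with hc
  set Φ := birkhoffSum (· + θ) F q with hΦ
  have hΦc : Continuous Φ := (continuous_birkhoffSum_add_right hF q).comp
    (show Continuous fun x : AddCircle L => (θ, x) by fun_prop)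
  have hP := hasSum_sq_norm_fourierCoeff_of_continuous
    (show Continuous fun x => (Φ x : ℂ) by fun_prop)
  have hsq : ∀ x, ‖(Φ x : ℂ)‖ ^ 2 = Φ x ^ 2 := fun x => by simp
  simp only [hsq] at hP
  have hinj : Function.Injective fun k : ℤ => k * q := fun i j h =>
    mul_right_cancel₀ (by exact_mod_cast hq0) h
  have hP' := (hinj.hasSum_iff (fun n hn => by
    rw [fourierCoeff_birkhoffSum hF hq, if_neg, norm_zero, zero_pow two_ne_zero]
    rintro ⟨k, rfl⟩
    exact hn ⟨k, mul_comm _ _⟩)).2 hP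
  have hle : ∀ k : ℤ, ‖c (k * q)‖ ^ 2 ≤ ‖c q‖ ^ 2 * (1 / (k : ℝ) ^ 2) := by
    have key : ∀ k : ℕ, k ≠ 0 → ‖c ((k : ℤ) * q)‖ ^ 2 ≤ ‖c q‖ ^ 2 * (1 / ((k : ℤ) : ℝ) ^ 2) := by
      intro k hk
      have h1 := hrec k hk
      have hk' : (0 : ℝ) < k := by positivity
      push_cast at h1 ⊢
      rw [mul_one_div, le_div_iff₀ (by positivity)]
      calc ‖c (k * q)‖ ^ 2 * (k : ℝ) ^ 2 = (k * ‖c (k * q)‖) ^ 2 := by ring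
        _ ≤ _ := by gcongr
    intro k
    obtain ⟨m, rfl | rfl⟩ := k.eq_nat_or_neg
    · rcases eq_or_ne m 0 with rfl | hm
      · simp [h0]
      · exact key m hm
    · rcases eq_or_ne m 0 with rfl | hm
      · simp [h0]
      · have := key m hm
        rw [neg_mul, hc, fourierCoeff_ofReal_neg, Complex.norm_conj]
        simpa using this
  calc ∫ x, Φ x ^ 2 ∂haarAddCircle = ∑' k : ℤ, _ := hP'.tsum_eq.symm
    _ ≤ ∑' k : ℤ, (q : ℝ) ^ 2 * (‖c q‖ ^ 2 * (1 / (k : ℝ) ^ 2)) := by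
        refine hP'.summable.tsum_le_tsum (fun k => ?_)
          ((summable_int_one_div_sq.mul_left _).mul_left _)
        simp only [Function.comp]
        rw [fourierCoeff_birkhoffSum hF hq, if_pos (dvd_mul_left _ _), norm_mul, mul_pow]
        simp only [RCLike.norm_natCast]
        gcongr
        exact hle k
    _ = (q * ‖c q‖) ^ 2 * ∑' k : ℤ, 1 / (k : ℝ) ^ 2 := by
        rw [tsum_mul_left, tsum_mul_left]; ring
    _ ≤ (q * ‖c q‖) ^ 2 * 4 := by gcongr; exact tsum_int_one_div_sq_le
    _ = _ := by ring

/-- A second-moment argument. With `A = q * ‖c q‖`, the L¹ norm of `Φ` is at least its `q`-th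
coefficient `A`, and the mean is zero, so the positive part has integral at least `A / 2`. As the
integral of `Φ ^ 2` is at most `4 * A ^ 2`, this positive part cannot live on a very small set or
mostly on large values. -/
theorem measureReal_birkhoffSum_ge {F : AddCircle L → ℝ} (hF : Continuous F) {θ : AddCircle L}
    {q : ℕ} (hq : addOrderOf θ = q) (hq0 : q ≠ 0)
    (h0 : fourierCoeff (fun x => (F x : ℂ)) 0 = 0)
    (hne : fourierCoeff (fun x => (F x : ℂ)) q ≠ 0)
    (hrec : ∀ k : ℕ, k ≠ 0 → k * ‖fourierCoeff (fun x => (F x : ℂ)) (k * q : ℕ)‖ ≤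
      ‖fourierCoeff (fun x => (F x : ℂ)) q‖) {ε : ℝ}
    (hε : 32 * (q * ‖fourierCoeff (fun x => (F x : ℂ)) q‖) ≤ ε) :
    1 / 32 ≤ haarAddCircle.real
      {x | 0 < birkhoffSum (· + θ) F q x ∧ birkhoffSum (· + θ) F q x < ε} := by
  have hI := integral_birkhoffSum_sq_le hF hq hq0 h0 hrec
  have hcoef := fourierCoeff_birkhoffSum hF hq
  set c := fourierCoeff (fun x => (F x : ℂ)) with hc
  set Φ := birkhoffSum (· + θ) F q with hΦ
  set A : ℝ := q * ‖c q‖ with hA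
  have hA0 : 0 < A := by
    have : 0 < ‖c q‖ := norm_pos_iff.2 hne
    positivity
  have hε0 : 0 < ε := by linarith
  have hΦc : Continuous Φ := (continuous_birkhoffSum_add_right hF q).comp
    (show Continuous fun x : AddCircle L => (θ, x) by fun_prop)
  have hint0 : ∫ x, Φ x ∂haarAddCircle = 0 := by
    have h1 := hcoef 0
    rw [if_pos (dvd_zero _), h0, mul_zero] at h1
    simp only [fourierCoeff, neg_zero, fourier_zero, one_smul] at h1
    exact Complex.ofReal_eq_zero.1 ((integral_complex_ofReal (f := Φ)).symm.trans h1)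
  have habs : A ≤ ∫ x, |Φ x| ∂haarAddCircle := by
    have h1 := hcoef q
    rw [if_pos dvd_rfl] at h1
    calc A = ‖fourierCoeff (fun x => (Φ x : ℂ)) q‖ := by rw [h1]; simp [hA]
      _ ≤ ∫ x, ‖fourier (-(q : ℤ)) x • (Φ x : ℂ)‖ ∂haarAddCircle := norm_integral_le_integral_norm _
      _ = _ := by
        congr 1; ext x
        rw [norm_smul, fourier_apply, Circle.norm_coe, one_mul, Complex.norm_real, Real.norm_eq_abs]
  have hP : MeasurableSet {x | 0 < Φ x ∧ Φ x < ε} :=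
    (measurableSet_lt measurable_const hΦc.measurable).inter
      (measurableSet_lt hΦc.measurable measurable_const)
  set P := {x | 0 < Φ x ∧ Φ x < ε} with hPdef
  -- On `P` this is `(Φ x - 8 * A) ^ 2 ≥ 0`; where `Φ x ≥ ε` it is `Φ x ≤ Φ x ^ 2 / ε`. Integrating
  -- gives `A / 2 ≤ 3 / 8 * A + 4 * A * μ(P)`, whence `1 / 32`.
  have hpt : ∀ x, (|Φ x| + Φ x) / 2 ≤
      (1 / (16 * A) + 1 / ε) * Φ x ^ 2 + 4 * A * P.indicator 1 x := by
    intro x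
    have hAi : (1 / (16 * A)) * (16 * A) = 1 := by field_simp
    have hei : (1 / ε) * ε = 1 := by field_simp
    have hA1 : 0 < 1 / (16 * A) := by positivity
    have he1 : 0 < 1 / ε := by positivity
    by_cases h1 : 0 < Φ x
    · rw [abs_of_pos h1]
      by_cases h2 : Φ x < ε
      · rw [Set.indicator_of_mem (show x ∈ P from ⟨h1, h2⟩)]
        simp only [Pi.one_apply]
        have e1 : 0 ≤ 1 / ε * Φ x ^ 2 := by positivity
        have e2 : Φ x ≤ 1 / (16 * A) * Φ x ^ 2 + 4 * A := by
          have : 0 ≤ 1 / (16 * A) * (Φ x - 8 * A) ^ 2 := by positivity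
          nlinarith
        linarith
      · rw [Set.indicator_of_notMem (fun h => h2 h.2)]
        rw [not_lt] at h2
        have e1 : 0 ≤ 1 / (16 * A) * Φ x ^ 2 := by positivity
        have e2 : Φ x ≤ 1 / ε * Φ x ^ 2 := by
          rw [one_div, ← div_eq_inv_mul, le_div_iff₀ hε0]
          nlinarith
        linarith
    · rw [abs_of_nonpos (not_lt.1 h1)]
      have e1 : 0 ≤ P.indicator (1 : AddCircle L → ℝ) x := Set.indicator_nonneg (by simp) x
      have : 0 ≤ (1 / (16 * A) + 1 / ε) * Φ x ^ 2 := by positivity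
      have : 0 ≤ 4 * A * P.indicator 1 x := by positivity
      linarith
  have hPi : Integrable (P.indicator (1 : AddCircle L → ℝ)) haarAddCircle :=
    (integrable_indicator_iff hP).2 (integrable_const _).integrableOn
  have hi1 : Integrable (fun x => |Φ x|) haarAddCircle := integrable_of_continuous (by fun_prop)
  have hi2 : Integrable Φ haarAddCircle := integrable_of_continuous hΦc
  have hi3 : Integrable (fun x => Φ x ^ 2) haarAddCircle := integrable_of_continuous (by fun_prop)
  have hfin := integral_mono ((hi1.add hi2).div_const 2)
    ((hi3.const_mul (1 / (16 * A) + 1 / ε)).add (hPi.const_mul (4 * A))) hpt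
  simp only [Pi.add_apply] at hfin
  rw [integral_div, integral_add hi1 hi2, hint0, integral_add (hi3.const_mul _) (hPi.const_mul _),
    integral_const_mul, integral_const_mul, integral_indicator_one hP] at hfin
  have h1 : (1 / (16 * A) + 1 / ε) * ∫ x, Φ x ^ 2 ∂haarAddCircle ≤ 3 / 8 * A := by
    calc (1 / (16 * A) + 1 / ε) * ∫ x, Φ x ^ 2 ∂haarAddCircle
        ≤ (1 / (16 * A) + 1 / (32 * A)) * (4 * A ^ 2) := by gcongr
      _ = 3 / 8 * A := by field_simp; norm_num
  have h2 : A * (1 / 32) ≤ A * haarAddCircle.real P := by linarith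
  exact le_of_mul_le_mul_left h2 hA0

theorem exists_record {w : ℕ → ℝ} (hw : Tendsto w atTop (𝓝 0)) (hpos : ∃ᶠ n in atTop, 0 < w n)
    (N : ℕ) : ∃ q ≥ N, 0 < w q ∧ ∀ n ≥ q, w n ≤ w q := by
  obtain ⟨n₀, hn₀, hw₀⟩ := (hpos.and_eventually (eventually_ge_atTop N)).exists
  have hfin : Set.Finite {n | N ≤ n ∧ w n₀ ≤ w n} := by
    obtain ⟨M, hM⟩ := eventually_atTop.1 (hw.eventually (gt_mem_nhds hn₀))
    refine (Set.finite_lt_nat M).subset fun n hn => ?_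
    by_contra hcon
    exact absurd (hM n (not_lt.1 hcon)) (not_lt.2 hn.2)
  obtain ⟨q, ⟨hq1, hq2⟩, hq⟩ := Set.exists_max_image _ w hfin ⟨n₀, hw₀, le_rfl⟩
  refine ⟨q, hq1, hn₀.trans_le hq2, fun n hn => ?_⟩
  by_cases h : w n₀ ≤ w n
  · exact hq n ⟨hq1.trans hn, h⟩
  · exact (not_le.1 h).le.trans hq2

/-- Otherwise `F` is a trigonometric polynomial, hence real-analytic, and an analytic function
vanishing on an interval vanishes identically. -/
theorem frequently_fourierCoeff_ne_zero {F : AddCircle L → ℝ} (hF : Continuous F) {u v : ℝ}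
    (huv : u < v) (hz : ∀ x ∈ Set.Ioo u v, F (x : AddCircle L) = 0) (hne : ∃ x, F x ≠ 0) :
    ∃ᶠ n : ℕ in atTop, fourierCoeff (fun x => (F x : ℂ)) n ≠ 0 := by
  intro hcon
  simp only [not_not] at hcon
  obtain ⟨N, hN⟩ := eventually_atTop.1 hcon
  set c := fourierCoeff (fun x => (F x : ℂ)) with hc
  have hsupp : ∀ n ∉ Finset.Icc (-(N : ℤ)) N, c n = 0 := by
    intro n hn
    rw [Finset.mem_Icc, not_and_or, not_le, not_le] at hn
    have key : ∀ m : ℤ, (N : ℤ) < m → c m = 0 := by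
      intro m hm
      lift m to ℕ using by omega
      exact hN m (by omega)
    rcases hn with h | h
    · have := key (-n) (by omega)
      rw [← neg_neg n, hc, fourierCoeff_ofReal_neg, ← hc, this, map_zero]
    · exact key n h
  have hsum : ∀ x : ℝ, (F x : ℂ) = ∑ n ∈ Finset.Icc (-(N : ℤ)) N,
      c n * Complex.exp (2 * Real.pi * Complex.I * n * x / L) := by
    intro x
    have h1 := has_pointwise_sum_fourier_series_of_summable
      (f := ⟨fun x => (F x : ℂ), by fun_prop⟩) (summable_of_ne_finset_zero hsupp) (x : AddCircle L)
    have h2 := h1.unique (hasSum_sum_of_ne_finset_zero (s := Finset.Icc (-(N : ℤ)) N)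
      (fun n hn => by
        have := hsupp n hn
        rw [hc] at this
        simp [this]))
    simpa [fourier_coe_apply] using h2
  have han : AnalyticOnNhd ℝ (fun x : ℝ => (F x : ℂ)) Set.univ := by
    have : (fun x : ℝ => (F x : ℂ)) = fun x : ℝ => ∑ n ∈ Finset.Icc (-(N : ℤ)) N,
      c n * Complex.exp (2 * Real.pi * Complex.I * n * x / L) := funext hsum
    rw [this]
    intro x _
    refine Finset.analyticAt_fun_sum _ fun n _ => analyticAt_const.mul ?_
    have h1 : AnalyticAt ℝ (fun x : ℝ => 2 * Real.pi * Complex.I * n * x / L) x := by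
      have : AnalyticAt ℝ (fun x : ℝ => (x : ℂ)) x := Complex.ofRealCLM.analyticAt x
      exact (analyticAt_const.mul this).div_const
    exact (analyticAt_cexp.restrictScalars (𝕜 := ℝ)).comp h1
  have hmid : (u + v) / 2 ∈ Set.Ioo u v := ⟨by linarith, by linarith⟩
  have h0 := han.eqOn_zero_of_preconnected_of_eventuallyEq_zero isPreconnected_univ
    (Set.mem_univ ((u + v) / 2)) (by
      filter_upwards [Ioo_mem_nhds hmid.1 hmid.2] with x hx
      simp [hz x hx])
  obtain ⟨x, hx⟩ := hne
  obtain ⟨y, rfl⟩ := QuotientAddGroup.mk_surjective x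
  exact hx (Complex.ofReal_eq_zero.1 (h0 (Set.mem_univ y)))

end Fourier

/-! ### Density of good angles and the Baire argument -/

section Density

/-- Since `q` does not divide `C!`, some prime power dividing `q` does not divide `C!` either, and
so exceeds `C`. -/
theorem exists_prime_pow_dvd_of_factorial_lt {C q : ℕ} (hq : Nat.factorial C < q) :
    ∃ p e m : ℕ, p.Prime ∧ ¬ p ∣ m ∧ q = p ^ e * m ∧ C < p ^ e := by
  have h1 : ¬ q ∣ Nat.factorial C := fun h =>
    absurd (Nat.le_of_dvd (Nat.factorial_pos _) h) (not_le.2 hq)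
  rw [Nat.dvd_iff_prime_pow_dvd_dvd] at h1
  push Not at h1
  obtain ⟨p, k, hp, hk1, hk2⟩ := h1
  obtain ⟨e, m, hm, hqm⟩ := Nat.exists_eq_pow_mul_and_not_dvd (by omega : q ≠ 0) p hp.ne_one
  refine ⟨p, e, m, hp, hm, hqm, ?_⟩
  have hc : Nat.Coprime (p ^ k) m := Nat.Coprime.pow_left _ ((hp.coprime_iff_not_dvd).2 hm)
  rw [hqm] at hk1
  have hle := Nat.le_of_dvd (pow_pos hp.pos _) (hc.dvd_of_dvd_mul_right hk1)
  refine lt_of_lt_of_le ?_ hle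
  by_contra hcon
  exact hk2 (Nat.dvd_factorial (pow_pos hp.pos _) (not_lt.1 hcon))

/-- Reduced fractions of a given large denominator are `δ`-dense. -/
theorem exists_gcd_eq_one_abs_div_sub_le {δ : ℝ} (hδ : 0 < δ) :
    ∃ N : ℕ, ∀ q ≥ N, ∀ x : ℝ, ∃ p : ℤ, Int.gcd p q = 1 ∧ |(p : ℝ) / q - x| ≤ δ := by
  refine ⟨Nat.factorial ⌈1 / δ⌉₊ + 1, fun q hq x => ?_⟩
  obtain ⟨p, e, m, hp, hpm, hqm, hC⟩ := exists_prime_pow_dvd_of_factorial_lt (Nat.lt_of_succ_le hq)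
  have hq0 : 0 < q := by omega
  have hm0 : 0 < m := by
    rcases Nat.eq_zero_or_pos m with rfl | h
    · simp at hpm
    · exact h
  have hpi : Irreducible (p : ℤ) := (Nat.prime_iff_prime_int.1 hp).irreducible
  -- Chosen so that `(p ^ e + t * m) / q = x`. Of two consecutive integers near `t` one is prime to
  -- `p`, and an error of `1` in `t` costs only `1 / p ^ e`.
  set t : ℝ := (x * q - (p ^ e : ℕ)) / m with ht
  obtain ⟨y, hy, hyt⟩ : ∃ y : ℤ, ¬ (p : ℤ) ∣ y ∧ |(y : ℝ) - t| ≤ 1 := by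
    by_cases h : (p : ℤ) ∣ ⌊t⌋
    · refine ⟨⌊t⌋ + 1, fun h' => ?_, ?_⟩
      · exact (Nat.prime_iff_prime_int.1 hp).not_dvd_one ((dvd_add_right h).1 h')
      · have := Int.floor_le t
        have := Int.lt_floor_add_one t
        push_cast
        rw [abs_le]; constructor <;> linarith
    · refine ⟨⌊t⌋, h, ?_⟩
      have := Int.floor_le t
      have := Int.lt_floor_add_one t
      rw [abs_le]; constructor <;> linarith
  -- Prime to `p` because `y * m` is, and prime to `m` because `p ^ e` is.
  refine ⟨p ^ e + y * m, ?_, ?_⟩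
  · rw [← Int.isCoprime_iff_gcd_eq_one, hqm]
    push_cast
    have hpm' : IsCoprime (p : ℤ) m := hpi.coprime_iff_not_dvd.2 (by exact_mod_cast hpm)
    refine IsCoprime.mul_right ?_ ?_
    · have h1 : IsCoprime (y * m) ((p : ℤ) ^ e) :=
        ((hpi.coprime_iff_not_dvd.2 hy).symm.mul_left hpm'.symm).pow_right
      have := h1.add_mul_right_left 1
      rwa [one_mul, add_comm] at this
    · exact (hpm'.pow_left (m := e)).add_mul_right_left y
  · have hm0' : (0 : ℝ) < m := by exact_mod_cast hm0
    have hpe : (0 : ℝ) < (p : ℝ) ^ e := by have := hp.pos; positivity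
    have hq' : (q : ℝ) = p ^ e * m := by rw [hqm]; push_cast; ring
    have h1 : ((p ^ e + y * m : ℤ) : ℝ) / q - x = (y - t) / (p : ℝ) ^ e := by
      rw [ht, hq']; push_cast; field_simp; ring
    rw [h1, abs_div, abs_of_pos hpe]
    have h2 : 1 / δ ≤ (p : ℝ) ^ e :=
      (Nat.le_ceil _).trans (by exact_mod_cast hC.le)
    rw [div_le_iff₀ hpe]
    rw [div_le_iff₀ hδ] at h2
    linarith

variable {L : ℝ} [hL : Fact (0 < L)]

theorem HasReturns.mono {θ : AddCircle L} {F : AddCircle L → ℝ} {c : ℝ≥0∞} {a a' ε ε' : ℝ}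
    (h : HasReturns θ F c a' ε') (hε : ε' + |a' - a| ≤ ε) : HasReturns θ F c a ε := by
  obtain ⟨W, n, hW, hn, hc, hinj, hWn⟩ := h
  refine ⟨W, n, hW, hn, hc, hinj, fun x hx => ?_⟩
  obtain ⟨h1, h2⟩ := hWn x hx
  have := abs_nonneg (a' - a)
  exact ⟨by linarith, (abs_sub_le _ a' _).trans (by linarith)⟩

/-- The coefficients dictate the denominator `q`, so the approximation of the given angle has to
come from the choice of the numerator alone. -/
theorem dense_eventually_hasReturns {F : AddCircle L → ℝ} (hF : Continuous F)
    (h0 : fourierCoeff (fun x => (F x : ℂ)) 0 = 0)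
    (hdec : Tendsto (fun n : ℕ => n * ‖fourierCoeff (fun x => (F x : ℂ)) n‖) atTop (𝓝 0))
    (hfr : ∃ᶠ n : ℕ in atTop, fourierCoeff (fun x => (F x : ℂ)) n ≠ 0)
    {a ε : ℝ} (ha : 0 < a) (hε : 0 < ε) :
    Dense {θ : ℝ | ∀ᶠ θ' in 𝓝 (θ : AddCircle L),
      HasReturns θ' F (ENNReal.ofReal (L / 100)) a ε} := by
  have hL0 : 0 < L := hL.out
  rw [Metric.dense_iff]
  intro θ₁ δ hδ
  obtain ⟨N₁, hN₁⟩ := exists_gcd_eq_one_abs_div_sub_le (δ := δ / (2 * L)) (by positivity)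
  obtain ⟨N₂, hN₂⟩ := eventually_atTop.1
    (hdec.eventually (gt_mem_nhds (show (0 : ℝ) < ε / 32 by positivity)))
  obtain ⟨q, hqN, hwq, hrec⟩ := exists_record hdec
    ((hfr.and_eventually (eventually_gt_atTop 0)).mono fun n hn => by
      have := norm_pos_iff.2 hn.1
      have := hn.2
      positivity) (max N₁ N₂)
  have hq0 : q ≠ 0 := by rintro rfl; simp at hwq
  obtain ⟨p, hpq, hpx⟩ := hN₁ q (le_of_max_le_left hqN) (θ₁ / L)
  have hq0' : (0 : ℝ) < q := by positivity
  refine ⟨p / q * L, ?_, ?_⟩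
  · rw [Metric.mem_ball, Real.dist_eq]
    have : (p : ℝ) / q * L - θ₁ = (p / q - θ₁ / L) * L := by field_simp
    rw [this, abs_mul, abs_of_pos hL0]
    calc |(p : ℝ) / q - θ₁ / L| * L ≤ δ / (2 * L) * L := by gcongr
      _ = δ / 2 := by field_simp
      _ < δ := by linarith
  have hord : addOrderOf (((p : ℝ) / q * L : ℝ) : AddCircle L) = q :=
    addOrderOf_div_of_gcd_eq_one' (Nat.pos_of_ne_zero hq0) hpq
  have hne : fourierCoeff (fun x => (F x : ℂ)) q ≠ 0 := by
    intro h; simp [h] at hwq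
  have hm := measureReal_birkhoffSum_ge hF hord hq0 h0 hne (fun k hk => by
    have h1 := hrec (k * q) (Nat.le_mul_of_pos_left _ (Nat.pos_of_ne_zero hk))
    push_cast at h1 ⊢
    have h2 : (q : ℝ) * (k * ‖fourierCoeff (fun x => (F x : ℂ)) (k * q)‖) ≤
      q * ‖fourierCoeff (fun x => (F x : ℂ)) q‖ := by linarith
    exact le_of_mul_le_mul_left h2 hq0') (ε := ε)
    (by have := hN₂ q (le_of_max_le_right hqN); linarith)
  refine eventually_hasReturns_of_nsmul_eq_zero hF (hord ▸ addOrderOf_nsmul_eq_zero _) ha hε ?_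
  -- Normalised measure `1 / 32` is volume `L / 32`, whose half `L / 64` exceeds `L / 100`.
  rw [volume_eq_smul_haarAddCircle, Measure.smul_apply, smul_eq_mul, ← ofReal_measureReal,
    ← ENNReal.ofReal_mul hL0.le, ← ENNReal.ofReal_ofNat 2, ← ENNReal.ofReal_div_of_pos two_pos,
    ENNReal.ofReal_lt_ofReal_iff (by nlinarith)]
  nlinarith

theorem dense_setOf_ergodic_rotation {F : AddCircle L → ℝ} (hF : Continuous F)
    (h0 : fourierCoeff (fun x => (F x : ℂ)) 0 = 0)
    (hdec : Tendsto (fun n : ℕ => n * ‖fourierCoeff (fun x => (F x : ℂ)) n‖) atTop (𝓝 0))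
    (hfr : ∃ᶠ n : ℕ in atTop, fourierCoeff (fun x => (F x : ℂ)) n ≠ 0) :
    Dense {θ : ℝ | Ergodic (skewProduct (· + (θ : AddCircle L)) F)
      ((volume : Measure (AddCircle L)).prod volume)} := by
  have hL0 : 0 < L := hL.out
  set c : ℝ≥0∞ := ENNReal.ofReal (L / 100) with hc
  -- Rational `a` and tolerances `1 / (k + 1)` keep the intersection countable; `HasReturns.mono`
  -- recovers all real values.
  have hret : ∀ a : {a : ℚ // 0 < a}, ∀ k : ℕ,
      ∀ᶠ θ : ℝ in residual ℝ, HasReturns (θ : AddCircle L) F c a (1 / (k + 1)) := by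
    intro a k
    have hd := dense_eventually_hasReturns (L := L) hF h0 hdec hfr
      (show (0 : ℝ) < (a : ℚ) by exact_mod_cast a.2) (show (0 : ℝ) < 1 / (k + 1) by positivity)
    have ho : IsOpen {θ : ℝ | ∀ᶠ θ' in 𝓝 (θ : AddCircle L), HasReturns θ' F c a (1 / (k + 1))} :=
      isOpen_setOfPred_eventually_nhds.preimage (AddCircle.continuous_mk' L)
    filter_upwards [residual_of_dense_open ho hd] with θ hθ
    exact hθ.self_of_nhds
  have hord : ∀ (n : {n : ℕ // 0 < n}) (m : ℤ), ∀ᶠ θ : ℝ in residual ℝ, θ ≠ m * L / n := by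
    intro n m
    exact residual_of_dense_open isOpen_compl_singleton (dense_compl_singleton _)
  refine (dense_of_mem_residual (s := {θ : ℝ | (∀ (a : {a : ℚ // 0 < a}) (k : ℕ),
    HasReturns (θ : AddCircle L) F c a (1 / (k + 1))) ∧
    ∀ (n : {n : ℕ // 0 < n}) (m : ℤ), θ ≠ m * L / n}) ?_).mono ?_
  · refine (eventually_countable_forall.2 fun a => eventually_countable_forall.2 (hret a)).and
      (eventually_countable_forall.2 fun n => eventually_countable_forall.2 (hord n))
  · rintro θ ⟨h1, h2⟩
    refine ergodic_skewProduct_of_hasReturns hF.measurable (ergodic_add_right.2 ?_) (c := c)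
      (by simp [hc, hL0]) ?_
    · rw [addOrderOf_eq_zero_iff']
      intro n hn hcon
      rw [← AddCircle.coe_nsmul, AddCircle.coe_eq_zero_iff] at hcon
      obtain ⟨m, hm⟩ := hcon
      refine h2 ⟨n, hn⟩ m ?_
      have : (0 : ℝ) < n := by exact_mod_cast hn
      simp only [zsmul_eq_mul, nsmul_eq_mul] at hm
      field_simp
      linarith
    · intro a ha ε hε
      obtain ⟨k, hk⟩ := exists_nat_one_div_lt (half_pos hε)
      obtain ⟨a', ha1, ha2⟩ := exists_rat_btwn (show a < a + ε / 2 by linarith)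
      refine (h1 ⟨a', by exact_mod_cast ha.trans ha1⟩ k).mono ?_
      simp only
      rw [abs_of_pos (by linarith)]
      linarith

end Density

/-! ### Oscillatory integrals against functions of bounded variation -/

section Decay

/-- Bounded variation on the whole set bounds both Jordan parts, so they extend to monotone
functions on the line, with values available at the missing endpoint `1`. -/
theorem BoundedVariationOn.exists_monotone_sub_monotone {f : ℝ → ℝ} {s : Set ℝ}
    (h : BoundedVariationOn f s) :
    ∃ p q : ℝ → ℝ, Monotone p ∧ Monotone q ∧ ∀ x ∈ s, f x = p x - q x := by
  rcases s.eq_empty_or_nonempty with rfl | ⟨c, hc⟩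
  · exact ⟨id, id, monotone_id, monotone_id, by simp⟩
  obtain ⟨p, q, hp, hq, hpq, hvar⟩ := h.locallyBoundedVariationOn.exists_monotoneOn_sub_monotoneOn'
  set V := (eVariationOn f s).toReal with hV
  have hbd : ∀ x ∈ s, |p x - p c| ≤ V ∧ |q x - q c| ≤ V := by
    intro x hx
    have h1 := hvar c hc x hx
    have h2 := variationOnFromTo.abs_le_eVariationOn h (a := c) (b := x)
    rw [← h1, abs_le] at h2
    rw [abs_le, abs_le]
    rcases le_total c x with hcx | hcx
    · have := hp hc hx hcx
      have := hq hc hx hcx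
      refine ⟨⟨?_, ?_⟩, ?_, ?_⟩ <;> linarith
    · have := hp hx hc hcx
      have := hq hx hc hcx
      refine ⟨⟨?_, ?_⟩, ?_, ?_⟩ <;> linarith
  obtain ⟨p', hp', hpp'⟩ := hp.exists_monotone_extension
    ⟨p c - V, by rintro _ ⟨x, hx, rfl⟩; have := abs_le.1 (hbd x hx).1; linarith⟩
    ⟨p c + V, by rintro _ ⟨x, hx, rfl⟩; have := abs_le.1 (hbd x hx).1; linarith⟩
  obtain ⟨q', hq', hqq'⟩ := hq.exists_monotone_extension
    ⟨q c - V, by rintro _ ⟨x, hx, rfl⟩; have := abs_le.1 (hbd x hx).2; linarith⟩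
    ⟨q c + V, by rintro _ ⟨x, hx, rfl⟩; have := abs_le.1 (hbd x hx).2; linarith⟩
  refine ⟨p', q', hp', hq', fun x hx => ?_⟩
  rw [← hpp' hx, ← hqq' hx, hpq]; rfl

variable {L : ℝ} [hL : Fact (0 < L)]

/-- A shift by half a period `h` reverses the sign of the character. Averaging the integral with its
shifted form leaves two end pieces of length `h` and an integral of `p (x + h) - p x`, which is
nonnegative and telescopes to end pieces again. The bound `L ≤ 2` ensures `h ≤ 1`. -/
theorem norm_integral_fourier_mul_monotone_le {p : ℝ → ℝ} (hp : Monotone p) (hL2 : L ≤ 2) {n : ℕ}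
    (hn : n ≠ 0) :
    ‖∫ x in (0 : ℝ)..1, fourier (-(n : ℤ)) (x : AddCircle L) * (p x : ℂ)‖ ≤
      (|p 0| + |p 1|) * L / n := by
  have hL0 : 0 < L := hL.out
  have hn0 : (0 : ℝ) < n := by positivity
  set h : ℝ := L / 2 / n with hh
  have hh0 : 0 < h := by positivity
  have hh1 : h ≤ 1 := by
    rw [hh, div_le_one hn0]
    have : (1 : ℝ) ≤ n := by exact_mod_cast Nat.pos_of_ne_zero hn
    linarith
  set M : ℝ := |p 0| + |p 1| with hM
  have hpM : ∀ x ∈ Set.Icc (0 : ℝ) 1, |p x| ≤ M := by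
    intro x hx
    have h1 := hp hx.1
    have h2 := hp hx.2
    have := neg_abs_le (p 0)
    have := le_abs_self (p 1)
    have := abs_nonneg (p 0)
    have := abs_nonneg (p 1)
    rw [abs_le]; constructor <;> linarith
  set E : ℝ → ℂ := fun x => fourier (-(n : ℤ)) (x : AddCircle L) with hE
  have hEc : Continuous E := (map_continuous (fourier (-(n : ℤ)))).comp (AddCircle.continuous_mk' _)
  have hEn : ∀ x, ‖E x‖ = 1 := fun x => by simp only [hE, fourier_apply, Circle.norm_coe]
  have hEh : ∀ x, E (x + h) = - E x := by
    intro x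
    have h1 := fourier_add_half_inv_index (T := L) (n := -(n : ℤ)) (by omega) hL0
      ((x + h : ℝ) : AddCircle L)
    have h2 : ((x + h : ℝ) : AddCircle L) + ((L / 2 / (-(n : ℤ) : ℤ) : ℝ) : AddCircle L) = x := by
      rw [← AddCircle.coe_add]; congr 1; rw [hh]; push_cast; field_simp; ring
    rw [h2] at h1
    simp only [hE, h1, neg_neg]
  have hpi : ∀ a b, IntervalIntegrable p volume a b := fun a b => hp.intervalIntegrable
  have hpic : ∀ a b, IntervalIntegrable (fun x => (p x : ℂ)) volume a b := fun a b =>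
    ⟨(hpi a b).1.ofReal, (hpi a b).2.ofReal⟩
  have hph : Monotone fun x => p (x + h) := fun x y hxy => hp (by linarith)
  have hphi : ∀ a b, IntervalIntegrable (fun x => p (x + h)) volume a b := fun a b =>
    hph.intervalIntegrable
  have hphic : ∀ a b, IntervalIntegrable (fun x => (p (x + h) : ℂ)) volume a b := fun a b =>
    ⟨(hphi a b).1.ofReal, (hphi a b).2.ofReal⟩
  have hEp : ∀ a b, IntervalIntegrable (fun x => E x * (p x : ℂ)) volume a b := fun a b =>
    (hpic a b).continuousOn_mul hEc.continuousOn
  have hEph : ∀ a b, IntervalIntegrable (fun x => E x * (p (x + h) : ℂ)) volume a b := fun a b =>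
    (hphic a b).continuousOn_mul hEc.continuousOn
  set I := ∫ x in (0 : ℝ)..1, E x * (p x : ℂ) with hI
  have e1 : I = (∫ x in (0 : ℝ)..h, E x * (p x : ℂ)) -
      ∫ x in (0 : ℝ)..(1 - h), E x * (p (x + h) : ℂ) := by
    rw [hI, ← intervalIntegral.integral_add_adjacent_intervals (hEp 0 h) (hEp h 1),
      sub_eq_add_neg, ← intervalIntegral.integral_neg]
    congr 1
    have := intervalIntegral.integral_comp_add_right (a := 0) (b := 1 - h)
      (fun x => E x * (p x : ℂ)) h
    rw [zero_add, sub_add_cancel] at this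
    rw [← this]
    congr 1; ext x
    rw [hEh]; ring
  have e2 : I = (∫ x in (0 : ℝ)..(1 - h), E x * (p x : ℂ)) +
      ∫ x in (1 - h)..1, E x * (p x : ℂ) :=
    (intervalIntegral.integral_add_adjacent_intervals (hEp _ _) (hEp _ _)).symm
  have e3 : 2 * I = (∫ x in (0 : ℝ)..h, E x * (p x : ℂ)) + (∫ x in (1 - h)..1, E x * (p x : ℂ)) -
      ∫ x in (0 : ℝ)..(1 - h), E x * ((p (x + h) - p x : ℝ) : ℂ) := by
    have : (∫ x in (0 : ℝ)..(1 - h), E x * ((p (x + h) - p x : ℝ) : ℂ)) =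
        (∫ x in (0 : ℝ)..(1 - h), E x * (p (x + h) : ℂ)) -
          ∫ x in (0 : ℝ)..(1 - h), E x * (p x : ℂ) := by
      rw [← intervalIntegral.integral_sub (hEph _ _) (hEp _ _)]
      congr 1; ext x; push_cast; ring
    rw [this, two_mul]
    nth_rw 1 [e1]
    rw [e2]; ring
  have b1 : ‖∫ x in (0 : ℝ)..h, E x * (p x : ℂ)‖ ≤ M * h := by
    have := intervalIntegral.norm_integral_le_of_norm_le_const (a := 0) (b := h) (C := M)
      (f := fun x => E x * (p x : ℂ)) (fun x hx => by
        rw [Set.uIoc_of_le hh0.le] at hx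
        rw [norm_mul, hEn, one_mul, Complex.norm_real, Real.norm_eq_abs]
        exact hpM x ⟨hx.1.le, hx.2.trans hh1⟩)
    rwa [sub_zero, abs_of_pos hh0] at this
  have b2 : ‖∫ x in (1 - h)..1, E x * (p x : ℂ)‖ ≤ M * h := by
    have := intervalIntegral.norm_integral_le_of_norm_le_const (a := 1 - h) (b := 1) (C := M)
      (f := fun x => E x * (p x : ℂ)) (fun x hx => by
        rw [Set.uIoc_of_le (by linarith)] at hx
        rw [norm_mul, hEn, one_mul, Complex.norm_real, Real.norm_eq_abs]
        exact hpM x ⟨by linarith [hx.1], hx.2⟩)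
    rwa [_root_.sub_sub_cancel, abs_of_pos hh0] at this
  have b3 : ‖∫ x in (0 : ℝ)..(1 - h), E x * ((p (x + h) - p x : ℝ) : ℂ)‖ ≤ 2 * (M * h) := by
    have c1 : ‖∫ x in (0 : ℝ)..(1 - h), E x * ((p (x + h) - p x : ℝ) : ℂ)‖ ≤
        ∫ x in (0 : ℝ)..(1 - h), (p (x + h) - p x) := by
      refine intervalIntegral.norm_integral_le_of_norm_le (by linarith)
        (Eventually.of_forall fun x _ => ?_) ((hphi _ _).sub (hpi _ _))
      rw [norm_mul, hEn, one_mul, Complex.norm_real, Real.norm_eq_abs,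
        abs_of_nonneg (sub_nonneg.2 (hp (by linarith)))]
    have c2 : ∫ x in (0 : ℝ)..(1 - h), (p (x + h) - p x) =
        (∫ x in (1 - h)..1, p x) - ∫ x in (0 : ℝ)..h, p x := by
      rw [intervalIntegral.integral_sub (hphi _ _) (hpi _ _)]
      have := intervalIntegral.integral_comp_add_right (a := 0) (b := 1 - h) p h
      rw [zero_add, sub_add_cancel] at this
      rw [this]
      have d1 := intervalIntegral.integral_add_adjacent_intervals (hpi 0 h) (hpi h 1)
      have d2 := intervalIntegral.integral_add_adjacent_intervals (hpi 0 (1 - h)) (hpi (1 - h) 1)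
      linarith
    have c3 : |∫ x in (0 : ℝ)..h, p x| ≤ M * h := by
      have := intervalIntegral.norm_integral_le_of_norm_le_const (a := 0) (b := h) (C := M)
        (f := p) (fun x hx => by
          rw [Set.uIoc_of_le hh0.le] at hx
          exact hpM x ⟨hx.1.le, hx.2.trans hh1⟩)
      rwa [sub_zero, abs_of_pos hh0] at this
    have c4 : |∫ x in (1 - h)..1, p x| ≤ M * h := by
      have := intervalIntegral.norm_integral_le_of_norm_le_const (a := 1 - h) (b := 1) (C := M)
        (f := p) (fun x hx => by
          rw [Set.uIoc_of_le (by linarith)] at hx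
          exact hpM x ⟨by linarith [hx.1], hx.2⟩)
      rwa [_root_.sub_sub_cancel, abs_of_pos hh0] at this
    have := abs_le.1 c3
    have := abs_le.1 c4
    linarith
  have hfin : 2 * ‖I‖ ≤ 4 * (M * h) := by
    calc 2 * ‖I‖ = ‖2 * I‖ := by simp
      _ ≤ M * h + M * h + 2 * (M * h) := by
        rw [e3]
        exact (norm_sub_le _ _).trans (add_le_add ((norm_add_le _ _).trans (add_le_add b1 b2)) b3)
      _ = _ := by ring
  have : M * L / n = 2 * (M * h) := by rw [hh]; field_simp
  rw [this]
  linarith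

end Decay

/-! ### The extension by zero and its Fourier coefficients -/

section CircleExt

/-- The extension by zero of a function on `[0, 1)` to the circle of length `L`. -/
noncomputable def circleExt (L : ℝ) [Fact (0 < L)] (f : ℝ → ℝ) : AddCircle L → ℝ :=
  AddCircle.liftIco L 0 ((Set.Iio 1).indicator f)

variable {L : ℝ} [hL : Fact (0 < L)]

theorem circleExt_coe {f : ℝ → ℝ} {x : ℝ} (hx : x ∈ Set.Ico 0 L) :
    circleExt L f x = (Set.Iio 1).indicator f x :=
  AddCircle.liftIco_zero_coe_apply hx

theorem continuousOn_indicator_Iio {f : ℝ → ℝ} (hf : ContinuousOn f (Set.Ico 0 1))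
    (hf1 : Tendsto f (𝓝[<] 1) (𝓝 0)) : ContinuousOn ((Set.Iio 1).indicator f) (Set.Ici 0) := by
  intro x hx
  rcases lt_trichotomy x 1 with h | rfl | h
  · have h1 : ContinuousWithinAt f (Set.Ici 0) x := by
      refine (hf x ⟨hx, h⟩).mono_of_mem_nhdsWithin ?_
      exact inter_mem_nhdsWithin _ (Iio_mem_nhds h)
    refine h1.congr_of_eventuallyEq ?_ (Set.indicator_of_mem (Set.mem_Iio.2 h) _)
    filter_upwards [mem_nhdsWithin_of_mem_nhds (Iio_mem_nhds h)] with y hy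
      using Set.indicator_of_mem hy _
  · refine ContinuousAt.continuousWithinAt ?_
    rw [ContinuousAt, ← nhdsLT_sup_nhdsGE, Set.indicator_of_notMem (by simp)]
    refine Tendsto.sup (hf1.congr' ?_) (tendsto_const_nhds.congr' ?_)
    · filter_upwards [self_mem_nhdsWithin] with y hy using (Set.indicator_of_mem hy _).symm
    · filter_upwards [self_mem_nhdsWithin] with y hy
        using (Set.indicator_of_notMem (Set.notMem_Iio.2 (Set.mem_Ici.1 hy)) _).symm
  · refine ContinuousAt.continuousWithinAt (continuousAt_const.congr (f := fun _ => (0 : ℝ)) ?_)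
    filter_upwards [Ioi_mem_nhds h] with y hy
      using (Set.indicator_of_notMem (Set.notMem_Iio.2 (Set.mem_Ioi.1 hy).le) _).symm

theorem continuous_circleExt (hL1 : 1 < L) {f : ℝ → ℝ} (hf : ContinuousOn f (Set.Ico 0 1))
    (hf0 : f 0 = 0) (hf1 : Tendsto f (𝓝[<] 1) (𝓝 0)) : Continuous (circleExt L f) := by
  refine AddCircle.liftIco_zero_continuous ?_
    ((continuousOn_indicator_Iio hf hf1).mono fun x hx => hx.1)
  rw [Set.indicator_of_mem (by simp), Set.indicator_of_notMem (by simpa using hL1.le), hf0]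

theorem fourierCoeff_circleExt (hL1 : 1 < L) {f : ℝ → ℝ} (hf : ContinuousOn f (Set.Ico 0 1))
    (hf1 : Tendsto f (𝓝[<] 1) (𝓝 0)) (n : ℤ) :
    fourierCoeff (fun x => (circleExt L f x : ℂ)) n =
      (1 / L : ℝ) • ∫ x in (0 : ℝ)..1, fourier (-n) (x : AddCircle L) *
        (((Set.Iio 1).indicator f x : ℝ) : ℂ) := by
  rw [fourierCoeff_eq_intervalIntegral _ _ 0, zero_add]
  congr 1
  have hEc : Continuous fun x : ℝ => fourier (-n) (x : AddCircle L) :=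
    (map_continuous (fourier (-n))).comp (AddCircle.continuous_mk' _)
  have hc := continuousOn_indicator_Iio hf hf1
  have hcc : ContinuousOn (fun x : ℝ => fourier (-n) (x : AddCircle L) *
      (((Set.Iio 1).indicator f x : ℝ) : ℂ)) (Set.Ici 0) :=
    hEc.continuousOn.mul (Complex.continuous_ofReal.comp_continuousOn hc)
  have h1 : ∫ x in (0 : ℝ)..L, fourier (-n) (x : AddCircle L) • (circleExt L f x : ℂ) =
      ∫ x in (0 : ℝ)..L, fourier (-n) (x : AddCircle L) * (((Set.Iio 1).indicator f x : ℝ) : ℂ) := by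
    refine intervalIntegral.integral_congr_ae ?_
    have : ∀ᵐ x : ℝ, x ≠ L := by simp [ae_iff]
    filter_upwards [this] with x hx hx'
    rw [Set.uIoc_of_le hL.out.le] at hx'
    rw [circleExt_coe ⟨hx'.1.le, lt_of_le_of_ne hx'.2 hx⟩, smul_eq_mul]
  rw [h1, ← intervalIntegral.integral_add_adjacent_intervals (b := 1)]
  · rw [add_eq_left]
    refine intervalIntegral.integral_zero_ae (Eventually.of_forall fun x hx => ?_)
    rw [Set.uIoc_of_le hL1.le] at hx
    rw [Set.indicator_of_notMem (Set.notMem_Iio.2 hx.1.le)]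
    simp
  · refine ContinuousOn.intervalIntegrable (hcc.mono ?_)
    rw [Set.uIcc_of_le zero_le_one]; exact fun x hx => hx.1
  · refine ContinuousOn.intervalIntegrable (hcc.mono ?_)
    rw [Set.uIcc_of_le hL1.le]; exact fun x hx => zero_le_one.trans hx.1

theorem fourierCoeff_circleExt_zero (hL1 : 1 < L) {f : ℝ → ℝ} (hf : ContinuousOn f (Set.Ico 0 1))
    (hf1 : Tendsto f (𝓝[<] 1) (𝓝 0)) (hint : ∫ x in Set.Ico (0 : ℝ) 1, f x = 0) :
    fourierCoeff (fun x => (circleExt L f x : ℂ)) 0 = 0 := by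
  rw [fourierCoeff_circleExt hL1 hf hf1]
  have : ∫ x in (0 : ℝ)..1, fourier (-0) (x : AddCircle L) * (((Set.Iio 1).indicator f x : ℝ) : ℂ) =
      ((∫ x in Set.Ico (0 : ℝ) 1, f x : ℝ) : ℂ) := by
    rw [intervalIntegral.integral_of_le zero_le_one, ← integral_Ico_eq_integral_Ioc,
      ← integral_complex_ofReal]
    refine setIntegral_congr_fun measurableSet_Ico fun x hx => ?_
    simp only [neg_zero, fourier_zero, one_mul]
    rw [Set.indicator_of_mem (Set.mem_Iio.2 hx.2)]
  rw [this, hint]; simp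

/-- One integration by parts gains `1 / n`, and the bounded variation of the derivative gains
another. -/
theorem exists_norm_fourierCoeff_circleExt_le (hL1 : 1 < L) (hL2 : L ≤ 2) {f : ℝ → ℝ}
    (hf : IsC1AC f) (hf0 : f 0 = 0) (hf1 : Tendsto f (𝓝[<] 1) (𝓝 0)) :
    ∃ C : ℝ, ∀ n : ℕ, n ≠ 0 →
      ‖fourierCoeff (fun x => (circleExt L f x : ℂ)) n‖ ≤ C / (n : ℝ) ^ 2 := by
  obtain ⟨hd, -, hbv⟩ := hf
  have hL0 : 0 < L := hL.out
  obtain ⟨p, q, hp, hq, hpq⟩ := hbv.exists_monotone_sub_monotone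
  set M : ℝ := (|p 0| + |p 1|) + (|q 0| + |q 1|) with hM
  refine ⟨M * L, fun n hn => ?_⟩
  have hn0 : (0 : ℝ) < n := by positivity
  rw [fourierCoeff_circleExt hL1 hd.continuousOn hf1]
  have hEc : Continuous fun x : ℝ => fourier (-(n : ℤ)) (x : AddCircle L) :=
    (map_continuous (fourier (-(n : ℤ)))).comp (AddCircle.continuous_mk' _)
  have hpi : IntervalIntegrable (fun x => (p x : ℂ)) volume 0 1 :=
    ⟨hp.intervalIntegrable.1.ofReal, hp.intervalIntegrable.2.ofReal⟩
  have hqi : IntervalIntegrable (fun x => (q x : ℂ)) volume 0 1 :=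
    ⟨hq.intervalIntegrable.1.ofReal, hq.intervalIntegrable.2.ofReal⟩
  have hderiv : ∀ x ∈ Set.Ioo (min (0 : ℝ) 1) (max 0 1),
      HasDerivAt (fun x => (((Set.Iio 1).indicator f x : ℝ) : ℂ)) ((p x : ℂ) - q x) x := by
    intro x hx
    rw [min_eq_left zero_le_one, max_eq_right zero_le_one] at hx
    have h1 := (hd x ⟨hx.1.le, hx.2⟩).hasDerivWithinAt.hasDerivAt (Ico_mem_nhds hx.1 hx.2)
    rw [hpq x ⟨hx.1.le, hx.2⟩] at h1
    have h2 := h1.congr_of_eventuallyEq (f₁ := (Set.Iio 1).indicator f) (by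
      filter_upwards [Iio_mem_nhds hx.2] with y hy using Set.indicator_of_mem hy _)
    simpa using h2.ofReal_comp
  have hparts := intervalIntegral.integral_mul_deriv_eq_deriv_mul_of_hasDerivAt
    (a := 0) (b := 1) (u := fun x => (((Set.Iio 1).indicator f x : ℝ) : ℂ))
    (v := fun y : ℝ => (L : ℂ) / (-2 * Real.pi * Complex.I * (n : ℤ)) *
      fourier (-(n : ℤ)) (y : AddCircle L))
    (u' := fun x => (p x : ℂ) - q x) (v' := fun x => fourier (-(n : ℤ)) (x : AddCircle L))
    (Complex.continuous_ofReal.comp_continuousOn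
      ((continuousOn_indicator_Iio hd.continuousOn hf1).mono
        (by rw [Set.uIcc_of_le zero_le_one]; exact fun x hx => hx.1)))
    (continuous_const.mul hEc).continuousOn hderiv
    (fun x _ => has_antideriv_at_fourier_neg hL (by exact_mod_cast hn) x)
    (hpi.sub hqi) (hEc.intervalIntegrable _ _)
  have hb : ((Set.Iio 1).indicator f 1) = 0 := Set.indicator_of_notMem (by simp) _
  have ha : ((Set.Iio 1).indicator f 0) = 0 := by rw [Set.indicator_of_mem (by simp), hf0]
  -- The boundary terms vanish because `f` vanishes at `0` and the extension at `1`.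
  simp only [hb, ha, Complex.ofReal_zero, zero_mul, sub_zero, zero_sub] at hparts
  have hcomm : (∫ x in (0 : ℝ)..1, fourier (-(n : ℤ)) (x : AddCircle L) *
      (((Set.Iio 1).indicator f x : ℝ) : ℂ)) = ∫ x in (0 : ℝ)..1, (((Set.Iio 1).indicator f x : ℝ) : ℂ) *
        fourier (-(n : ℤ)) (x : AddCircle L) := by
    congr 1; ext x; ring
  have hsplit : (∫ x in (0 : ℝ)..1, ((p x : ℂ) - q x) *
      ((L : ℂ) / (-2 * Real.pi * Complex.I * (n : ℤ)) * fourier (-(n : ℤ)) (x : AddCircle L))) =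
      (L : ℂ) / (-2 * Real.pi * Complex.I * (n : ℤ)) *
      ((∫ x in (0 : ℝ)..1, fourier (-(n : ℤ)) (x : AddCircle L) * (p x : ℂ)) -
        ∫ x in (0 : ℝ)..1, fourier (-(n : ℤ)) (x : AddCircle L) * (q x : ℂ)) := by
    rw [← intervalIntegral.integral_sub (hpi.continuousOn_mul hEc.continuousOn)
      (hqi.continuousOn_mul hEc.continuousOn), ← intervalIntegral.integral_const_mul]
    congr 1; ext x; ring
  rw [hcomm, hparts, hsplit, norm_smul, norm_neg, norm_mul]
  have h1 : ‖(L : ℂ) / (-2 * Real.pi * Complex.I * (n : ℤ))‖ = L / (2 * Real.pi * n) := by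
    simp [abs_of_pos hL0, abs_of_pos Real.pi_pos]
  have h2 : ‖(∫ x in (0 : ℝ)..1, fourier (-(n : ℤ)) (x : AddCircle L) * (p x : ℂ)) -
        ∫ x in (0 : ℝ)..1, fourier (-(n : ℤ)) (x : AddCircle L) * (q x : ℂ)‖ ≤ M * L / n := by
    refine (norm_sub_le _ _).trans ((add_le_add
      (norm_integral_fourier_mul_monotone_le hp hL2 hn)
      (norm_integral_fourier_mul_monotone_le hq hL2 hn)).trans (le_of_eq ?_))
    rw [hM]; ring
  have hM0 : 0 ≤ M := by positivity
  rw [h1, Real.norm_of_nonneg (by positivity)]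
  calc 1 / L * (L / (2 * Real.pi * n) * _) ≤ 1 / L * (L / (2 * Real.pi * n) * (M * L / n)) := by
        gcongr
    _ = (M * L / n ^ 2) * (1 / (2 * Real.pi)) := by field_simp
    _ ≤ (M * L / n ^ 2) * 1 := by
        gcongr
        rw [div_le_one (by positivity)]
        linarith [Real.pi_gt_three]
    _ = _ := by ring

end CircleExt

/-! ### The exchange as an induced rotation -/

section Transfer

theorem quasiMeasurePreserving_coe_addCircle (L : ℝ) [hL : Fact (0 < L)] :
    Measure.QuasiMeasurePreserving ((↑) : ℝ → AddCircle L) volume volume := by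
  refine ⟨AddCircle.measurable_mk', Measure.AbsolutelyContinuous.mk fun s hs h0 => ?_⟩
  rw [Measure.map_apply AddCircle.measurable_mk' hs]
  have hU : ((↑) : ℝ → AddCircle L) ⁻¹' s = ⋃ k : ℤ, ((↑) ⁻¹' s ∩ Set.Ioc (k • L) ((k + 1) • L)) := by
    rw [← Set.inter_iUnion, iUnion_Ioc_zsmul hL.out, Set.inter_univ]
  rw [hU, measure_iUnion_null_iff]
  intro k
  have := (AddCircle.measurePreserving_mk L (k • L)).measure_preimage hs.nullMeasurableSet
  rw [h0, Measure.restrict_apply (AddCircle.measurable_mk' hs)] at this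
  rwa [add_smul, one_smul]

theorem measurePreserving_coe_lebUnit :
    MeasurePreserving (Subtype.val : UnitIco → ℝ) lebUnit (volume.restrict (Set.Ico 0 1)) :=
  measurePreserving_subtype_coe measurableSet_Ico

instance : IsProbabilityMeasure lebUnit :=
  ⟨by
    have := measurePreserving_coe_lebUnit.measure_preimage (s := Set.univ) nullMeasurableSet_univ
    simpa using this⟩

variable (p : LengthSimplex)

theorem LengthSimplex.lA_pos : 0 < p.lA := p.2.1

theorem LengthSimplex.lB_pos : 0 < p.lB := p.2.2.1

theorem LengthSimplex.lC_pos : 0 < p.lC := by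
  have := p.2.2.2
  unfold LengthSimplex.lC
  linarith

theorem LengthSimplex.lA_add_lB_add_lC : p.lA + p.lB + p.lC = 1 := by
  unfold LengthSimplex.lA LengthSimplex.lB LengthSimplex.lC
  ring

instance : Fact (0 < 1 + p.lB) := ⟨by linarith [p.lB_pos]⟩

theorem measurable_symIETFun : Measurable (symIETFun p) :=
  Measurable.ite measurableSet_Iio (by fun_prop)
    (Measurable.ite measurableSet_Iio (by fun_prop) (by fun_prop))

theorem measurable_symIET : Measurable (symIET p) :=
  Measurable.subtype_mk ((measurable_symIETFun p).comp measurable_subtype_coe)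

theorem volume_inter_Ico_add (s : Set ℝ) {a b c : ℝ} (hab : a ≤ b) (hbc : b ≤ c) :
    volume (s ∩ Set.Ico a b) + volume (s ∩ Set.Ico b c) = volume (s ∩ Set.Ico a c) := by
  rw [← measure_inter_add_sdiff (s ∩ Set.Ico a c) (measurableSet_Iio (a := b))]
  congr 2
  · ext x
    simp only [Set.mem_inter_iff, Set.mem_Ico, Set.mem_Iio]
    constructor
    · rintro ⟨h1, h2, h3⟩; exact ⟨⟨h1, h2, h3.trans_le hbc⟩, h3⟩
    · rintro ⟨⟨h1, h2, h3⟩, h4⟩; exact ⟨h1, h2, h4⟩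
  · ext x
    simp only [Set.mem_inter_iff, Set.mem_Ico, Set.mem_sdiff, Set.mem_Iio, not_lt]
    constructor
    · rintro ⟨h1, h2, h3⟩; exact ⟨⟨h1, hab.trans h2, h3⟩, h2⟩
    · rintro ⟨⟨h1, h2, h3⟩, h4⟩; exact ⟨h1, h4, h3⟩

theorem measurePreserving_symIETFun :
    MeasurePreserving (symIETFun p) (volume.restrict (Set.Ico 0 1))
      (volume.restrict (Set.Ico 0 1)) := by
  refine ⟨measurable_symIETFun p, Measure.ext fun E hE => ?_⟩
  have hA := p.lA_pos
  have hB := p.lB_pos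
  have hC := p.lC_pos
  have hsum := p.lA_add_lB_add_lC
  rw [Measure.map_apply (measurable_symIETFun p) hE,
    Measure.restrict_apply (measurable_symIETFun p hE), Measure.restrict_apply hE]
  have tr : ∀ {a b t : ℝ}, (∀ x ∈ Set.Ico a b, symIETFun p x = x + t) →
      volume (symIETFun p ⁻¹' E ∩ Set.Ico a b) = volume (E ∩ Set.Ico (a + t) (b + t)) := by
    intro a b t h
    rw [← measure_preimage_add_right volume t (E ∩ _)]
    congr 1; ext x
    simp only [Set.mem_inter_iff, Set.mem_preimage, Set.mem_Ico, add_le_add_iff_right,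
      add_lt_add_iff_right]
    constructor
    · rintro ⟨h1, h2⟩; rw [h x h2] at h1; exact ⟨h1, h2⟩
    · rintro ⟨h1, h2⟩; rw [← h x h2] at h1; exact ⟨h1, h2⟩
  have t1 := tr (a := 0) (b := p.lA) (t := p.lB + p.lC) (fun x hx => by
    rw [symIETFun, if_pos hx.2])
  have t2 := tr (a := p.lA) (b := p.lA + p.lB) (t := p.lC - p.lA) (fun x hx => by
    rw [symIETFun, if_neg (not_lt.2 hx.1), if_pos hx.2])
  have t3 := tr (a := p.lA + p.lB) (b := 1) (t := -(p.lA + p.lB)) (fun x hx => by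
    rw [symIETFun, if_neg (not_lt.2 (by linarith [hx.1])), if_neg (not_lt.2 hx.1), sub_eq_add_neg])
  rw [← volume_inter_Ico_add _ (show 0 ≤ p.lA + p.lB by linarith) (show p.lA + p.lB ≤ 1 by linarith),
    ← volume_inter_Ico_add _ hA.le (show p.lA ≤ p.lA + p.lB by linarith), t1, t2, t3,
    ← volume_inter_Ico_add E (show 0 ≤ p.lC + p.lB by linarith) (show p.lC + p.lB ≤ 1 by linarith),
    ← volume_inter_Ico_add E hC.le (show p.lC ≤ p.lC + p.lB by linarith)]
  rw [show 0 + (p.lB + p.lC) = p.lC + p.lB by ring,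
    show p.lA + (p.lB + p.lC) = 1 by linarith, show p.lA + (p.lC - p.lA) = p.lC by ring,
    show p.lA + p.lB + (p.lC - p.lA) = p.lC + p.lB by ring,
    show p.lA + p.lB + -(p.lA + p.lB) = 0 by ring,
    show 1 + -(p.lA + p.lB) = p.lC by linarith]
  ring

theorem measurePreserving_symIET : MeasurePreserving (symIET p) lebUnit lebUnit := by
  refine ⟨measurable_symIET p, Measure.ext fun E hE => ?_⟩
  obtain ⟨E', hE', rfl⟩ := hE
  rw [Measure.map_apply (measurable_symIET p) (measurable_subtype_coe hE')]
  have h1 := ((measurePreserving_symIETFun p).comp measurePreserving_coe_lebUnit).measure_preimage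
    hE'.nullMeasurableSet
  have h2 := measurePreserving_coe_lebUnit.measure_preimage hE'.nullMeasurableSet
  rw [h2, ← h1]
  rfl

/-- The outer intervals move by one rotation step; the middle one needs two, and its intermediate
point lies in the gap, where the extension is zero. -/
theorem coe_symIET_eq (f : ℝ → ℝ) (x : UnitIco) :
    ((symIET p x : ℝ) : AddCircle (1 + p.lB)) = ((x : ℝ) : AddCircle (1 + p.lB)) +
        ((1 - p.lA : ℝ) : AddCircle (1 + p.lB)) ∨
    (((symIET p x : ℝ) : AddCircle (1 + p.lB)) = ((x : ℝ) : AddCircle (1 + p.lB)) +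
        ((1 - p.lA : ℝ) : AddCircle (1 + p.lB)) + ((1 - p.lA : ℝ) : AddCircle (1 + p.lB)) ∧
      circleExt (1 + p.lB) f (((x : ℝ) : AddCircle (1 + p.lB)) +
        ((1 - p.lA : ℝ) : AddCircle (1 + p.lB))) = 0) := by
  have hA := p.lA_pos
  have hB := p.lB_pos
  have hC := p.lC_pos
  have hsum := p.lA_add_lB_add_lC
  obtain ⟨x, hx0, hx1⟩ := x
  simp only [symIET, symIETFun, ← AddCircle.coe_add]
  split_ifs with h1 h2
  · left; congr 1; linarith
  · right
    refine ⟨?_, ?_⟩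
    · rw [← AddCircle.coe_add_period, add_comm]
      congr 1; linarith
    · rw [circleExt_coe ⟨by linarith, by linarith⟩, Set.indicator_of_notMem]
      simp only [Set.mem_Iio, not_lt]; linarith
  · left
    rw [← AddCircle.coe_add_period]
    congr 1; linarith

/-- The first point of the forward orbit of the rotation by `1 - lA` on the circle of length
`1 + lB` that lies in `[0, 1)`. -/
noncomputable def firstEntry (y : AddCircle (1 + p.lB)) : UnitIco :=
  ⟨if (equivIco (1 + p.lB) 0 y : ℝ) < 1 then (equivIco (1 + p.lB) 0 y : ℝ)
    else (equivIco (1 + p.lB) 0 y : ℝ) - (p.lA + p.lB), by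
    have hA := p.lA_pos
    have hB := p.lB_pos
    have hC := p.lC_pos
    have hsum := p.lA_add_lB_add_lC
    obtain ⟨h0, h1⟩ := (equivIco (1 + p.lB) 0 y).2
    split_ifs with h
    · exact ⟨h0, h⟩
    · constructor <;> linarith⟩

theorem measurable_firstEntry : Measurable (firstEntry p) := by
  have h : Measurable fun y : AddCircle (1 + p.lB) => (equivIco (1 + p.lB) 0 y : ℝ) :=
    measurable_subtype_coe.comp (AddCircle.measurableEquivIco (1 + p.lB) 0).measurable
  exact Measurable.subtype_mk
    (Measurable.ite (measurableSet_lt h measurable_const) h (h.sub_const _))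

theorem val_firstEntry_coe {t : ℝ} (ht : t ∈ Set.Ico 0 (1 + p.lB)) :
    (firstEntry p (t : AddCircle (1 + p.lB)) : ℝ) = if t < 1 then t else t - (p.lA + p.lB) := by
  have h : (equivIco (1 + p.lB) 0 (t : AddCircle (1 + p.lB)) : ℝ) = t :=
    AddCircle.equivIco_coe_of_mem (by simpa using ht)
  simp only [firstEntry, h]

theorem firstEntry_coe (x : UnitIco) : firstEntry p ((x : ℝ) : AddCircle (1 + p.lB)) = x := by
  have hB := p.lB_pos
  ext
  rw [val_firstEntry_coe p ⟨x.2.1, x.2.2.trans (by linarith)⟩, if_pos x.2.2]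

/-- First entry intertwines the two skew products, except that it pauses while the orbit leaves the
gap, where the fibre does not move. Invariant sets therefore pull back to invariant sets. -/
theorem firstEntry_skewProduct (f : ℝ → ℝ) (z : AddCircle (1 + p.lB) × ℝ) :
    Prod.map (firstEntry p) id (skewProduct (· + ((1 - p.lA : ℝ) : AddCircle (1 + p.lB)))
      (circleExt (1 + p.lB) f) z) = Prod.map (firstEntry p) id z ∨
    Prod.map (firstEntry p) id (skewProduct (· + ((1 - p.lA : ℝ) : AddCircle (1 + p.lB)))
      (circleExt (1 + p.lB) f) z) =
        skewProduct (symIET p) (fun x => f x) (Prod.map (firstEntry p) id z) := by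
  have hA := p.lA_pos
  have hB := p.lB_pos
  have hC := p.lC_pos
  have hsum := p.lA_add_lB_add_lC
  obtain ⟨y, r⟩ := z
  obtain ⟨⟨t, ht⟩, rfl⟩ := (equivIco (1 + p.lB) 0).symm.surjective y
  have hy : (equivIco (1 + p.lB) 0).symm ⟨t, ht⟩ = (t : AddCircle (1 + p.lB)) := rfl
  rw [hy]
  rw [zero_add] at ht
  have hwrap : ((t + (1 - p.lA) : ℝ) : AddCircle (1 + p.lB)) =
      ((t - (p.lA + p.lB) : ℝ) : AddCircle (1 + p.lB)) := by
    rw [← AddCircle.coe_add_period _ (t - (p.lA + p.lB))]; congr 1; ring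
  simp only [skewProduct, Prod.map, id, ← AddCircle.coe_add, circleExt_coe ht, Prod.mk.injEq,
    Subtype.ext_iff, symIET]
  rw [val_firstEntry_coe p ht]
  by_cases h1 : t < 1
  · right
    rw [Set.indicator_of_mem (Set.mem_Iio.2 h1)]
    simp only [h1, if_true, and_true, symIETFun]
    split_ifs with h2 h3
    · rw [val_firstEntry_coe p ⟨by linarith [ht.1], by linarith⟩, if_pos (by linarith)]
      linarith
    · rw [val_firstEntry_coe p ⟨by linarith [ht.1], by linarith⟩, if_neg (by linarith)]
      linarith
    · rw [hwrap, val_firstEntry_coe p ⟨by linarith, by linarith⟩, if_pos (by linarith)]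
  · left
    have h2 := ht.2
    rw [Set.indicator_of_notMem (by simpa using h1), if_neg h1, hwrap,
      val_firstEntry_coe p ⟨by linarith, by linarith⟩, if_pos (by linarith)]
    simp

theorem quasiMeasurePreserving_coe_lebUnit (L : ℝ) [Fact (0 < L)] :
    Measure.QuasiMeasurePreserving (fun x : UnitIco => ((x : ℝ) : AddCircle L)) lebUnit volume :=
  (quasiMeasurePreserving_coe_addCircle L).comp
    (measurePreserving_coe_lebUnit.quasiMeasurePreserving.mono_right
      Measure.absolutelyContinuous_restrict)

theorem measurable_restrict_unitIco {f : ℝ → ℝ} (hf : ContinuousOn f (Set.Ico 0 1)) :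
    Measurable fun x : UnitIco => f x :=
  (continuousOn_iff_continuous_domRestrict.1 hf).measurable

theorem ergodic_skewProduct_symIET {f : ℝ → ℝ} (hf : ContinuousOn f (Set.Ico 0 1))
    (h : Ergodic (skewProduct (· + ((1 - p.lA : ℝ) : AddCircle (1 + p.lB)))
      (circleExt (1 + p.lB) f)) ((volume : Measure (AddCircle (1 + p.lB))).prod volume)) :
    Ergodic (skewProduct (symIET p) (fun x => f x)) (lebUnit.prod volume) := by
  refine ⟨measurePreserving_skewProduct (measurePreserving_symIET p)
    (measurable_restrict_unitIco hf), ⟨fun s hs hinv => ?_⟩⟩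
  have hm : Measurable (Prod.map (firstEntry p) (id : ℝ → ℝ)) :=
    (measurable_firstEntry p).prodMap measurable_id
  have hinv' : skewProduct (· + ((1 - p.lA : ℝ) : AddCircle (1 + p.lB))) (circleExt (1 + p.lB) f) ⁻¹'
      (Prod.map (firstEntry p) id ⁻¹' s) = Prod.map (firstEntry p) id ⁻¹' s := by
    ext z
    simp only [Set.mem_preimage]
    rcases firstEntry_skewProduct p f z with hz | hz
    · rw [hz]
    · rw [hz]
      exact Set.ext_iff.1 hinv _
  have hconst := h.toPreErgodic.aeconst_set (hm hs) hinv'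
  have hq : Measure.QuasiMeasurePreserving
      (Prod.map (fun x : UnitIco => ((x : ℝ) : AddCircle (1 + p.lB))) (id : ℝ → ℝ))
      (lebUnit.prod volume) (volume.prod volume) :=
    QuasiMeasurePreserving.prodMap (quasiMeasurePreserving_coe_lebUnit _)
      (Measure.QuasiMeasurePreserving.id _)
  have hsec : ∀ z : UnitIco × ℝ, Prod.map (firstEntry p) id
      (Prod.map (fun x : UnitIco => ((x : ℝ) : AddCircle (1 + p.lB))) (id : ℝ → ℝ) z) = z := by
    rintro ⟨x, r⟩
    simp [firstEntry_coe]
  rw [eventuallyConst_set] at hconst ⊢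
  rcases hconst with hc | hc
  · left
    filter_upwards [hq.ae hc] with z hz
    have hz' := Set.mem_preimage.1 hz
    rwa [hsec] at hz'
  · right
    filter_upwards [hq.ae hc] with z hz hz'
    refine hz (Set.mem_preimage.2 ?_)
    rwa [hsec]

/-- The region below the graph of the transfer function is invariant up to a null set, and in each
fibre both it and its complement are half-lines. -/
theorem not_ergodic_skewProduct_of_isCoboundary {X : Type*} [MeasurableSpace X] {μ : Measure X}
    [SFinite μ] [NeZero μ] {T : X → X} (hT : Measure.QuasiMeasurePreserving T μ μ) {f : X → ℝ}
    (hf : IsCoboundary μ T f) : ¬ Ergodic (skewProduct T f) (μ.prod volume) := by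
  intro hE
  obtain ⟨g, hg, hfg⟩ := hf
  obtain ⟨g', hg'm, hgg'⟩ := hg.aestronglyMeasurable
  have hcob : ∀ᵐ x ∂μ, f x = g' (T x) - g' x := by
    filter_upwards [hfg, hgg', hT.ae hgg'] with x h1 h2 h3
    rw [h1, h2, h3]
  have hs : MeasurableSet {z : X × ℝ | z.2 ≤ g' z.1} :=
    measurableSet_le measurable_snd (hg'm.measurable.comp measurable_fst)
  have hinv : skewProduct T f ⁻¹' {z : X × ℝ | z.2 ≤ g' z.1} =ᵐ[μ.prod volume]
      {z : X × ℝ | z.2 ≤ g' z.1} := by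
    filter_upwards [Measure.quasiMeasurePreserving_fst.ae hcob] with z hz
    apply propext
    change z.2 + f z.1 ≤ g' (T z.1) ↔ z.2 ≤ g' z.1
    rw [hz]
    constructor <;> intro h <;> linarith
  have hconst := hE.quasiErgodic.aeconst_set₀ hs.nullMeasurableSet hinv
  rw [eventuallyConst_set] at hconst
  rcases hconst with hc | hc
  · obtain ⟨x, hx⟩ := (Measure.ae_ae_of_ae_prod hc).exists
    have : volume (Set.Ioi (g' x)) = 0 := by
      refine measure_eq_zero_iff_ae_notMem.2 ?_
      filter_upwards [hx] with r hr
      exact not_lt.2 hr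
    simp at this
  · obtain ⟨x, hx⟩ := (Measure.ae_ae_of_ae_prod hc).exists
    have : volume (Set.Iic (g' x)) = 0 := measure_eq_zero_iff_ae_notMem.2 hx
    simp at this

end Transfer

/-! ### Small divisors for almost every rotation number -/

section SmallDivisors

theorem four_mul_abs_le_norm_fourier_one_sub_one {a : ℝ} (ha : |a| ≤ 1 / 2) :
    4 * |a| ≤ ‖(fourier 1 (a : UnitAddCircle) : ℂ) - 1‖ := by
  have h1 : (fourier 1 (a : UnitAddCircle) : ℂ) = Complex.exp (Complex.I * (2 * Real.pi * a : ℝ)) := by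
    rw [fourier_coe_apply]; congr 1; push_cast; ring
  rw [h1, Complex.norm_exp_I_mul_ofReal_sub_one, show 2 * Real.pi * a / 2 = Real.pi * a by ring,
    norm_mul, Real.norm_ofNat, Real.norm_eq_abs]
  have h2 : |Real.sin (Real.pi * a)| = Real.sin (Real.pi * |a|) := by
    have h3 : 0 ≤ Real.sin (Real.pi * |a|) :=
      Real.sin_nonneg_of_nonneg_of_le_pi (by positivity) (by nlinarith [Real.pi_pos])
    rcases abs_cases a with ⟨h, -⟩ | ⟨h, -⟩
    · rw [h] at h3 ⊢; rw [abs_of_nonneg h3]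
    · rw [h, mul_neg, Real.sin_neg] at h3 ⊢
      rw [abs_of_nonpos (by linarith)]
  rw [h2]
  have h4 := Real.mul_le_sin (x := Real.pi * |a|) (by positivity) (by nlinarith [Real.pi_pos])
  have h5 : 2 / Real.pi * (Real.pi * |a|) = 2 * |a| := by
    field_simp
  linarith

theorem lintegral_inv_norm_fourier_one_sub_one_ne_top :
    ∫⁻ y : UnitAddCircle, (‖(fourier 1 y : ℂ) - 1‖ₑ⁻¹) ^ (3 / 4 : ℝ) ≠ ∞ := by
  have hint : IntervalIntegrable (fun x : ℝ => |x| ^ (-(3 / 4) : ℝ)) volume (-(1 / 2)) (1 / 2) := by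
    refine intervalIntegrable_of_even (fun x => by rw [abs_neg]) (fun x hx => ?_)
    refine (intervalIntegral.intervalIntegrable_rpow' (r := -(3 / 4)) (by norm_num)).congr ?_
    intro y hy
    rw [Set.uIoc_of_le hx.le] at hy
    simp only [abs_of_pos hy.1]
  rw [intervalIntegrable_iff_integrableOn_Ioc_of_le (by norm_num)] at hint
  rw [← UnitAddCircle.lintegral_preimage (-(1 / 2)), show (-(1 / 2) + 1 : ℝ) = 1 / 2 by norm_num]
  refine ne_top_of_le_ne_top hint.lintegral_lt_top.ne ?_
  refine lintegral_mono_ae ?_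
  have h0 : ∀ᵐ x : ℝ ∂(volume.restrict (Set.Ioc (-(1 / 2)) (1 / 2))), x ≠ 0 :=
    ae_restrict_of_ae (by simp [ae_iff])
  filter_upwards [h0, ae_restrict_mem measurableSet_Ioc] with x hx hx'
  have hpos : 0 < |x| := abs_pos.2 hx
  have h1 := four_mul_abs_le_norm_fourier_one_sub_one (abs_le.2 ⟨hx'.1.le, hx'.2⟩)
  have h2 : ENNReal.ofReal |x| ≤ ‖(fourier 1 (x : UnitAddCircle) : ℂ) - 1‖ₑ := by
    rw [← ofReal_norm]
    exact ENNReal.ofReal_le_ofReal (by linarith)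
  calc (‖(fourier 1 (x : UnitAddCircle) : ℂ) - 1‖ₑ⁻¹) ^ (3 / 4 : ℝ)
      ≤ ((ENNReal.ofReal |x|)⁻¹) ^ (3 / 4 : ℝ) := by gcongr
    _ = ENNReal.ofReal (|x| ^ (-(3 / 4) : ℝ)) := by
        rw [ENNReal.inv_rpow, ENNReal.ofReal_rpow_of_pos hpos, ← ENNReal.ofReal_inv_of_pos
          (by positivity), Real.rpow_neg hpos.le]

theorem measurePreserving_nsmul_addCircle {T : ℝ} [Fact (0 < T)] {n : ℕ} (hn : n ≠ 0) :
    MeasurePreserving (fun y : AddCircle T => n • y) volume volume := by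
  rcases Nat.lt_or_ge 1 n with h | h
  · exact (AddCircle.ergodic_nsmul h).toMeasurePreserving
  · have : n = 1 := by omega
    subst this
    simp only [one_smul]
    exact MeasurePreserving.id _

theorem fourier_eq_fourier_one_nsmul {T : ℝ} (n : ℕ) (y : AddCircle T) :
    fourier n y = fourier 1 (n • y) := by
  simp [fourier_apply]

/-- Multiplication by `n` preserves Haar measure, so the `3 / 4` powers of `1 / (n ^ 2 * ‖fourier n
α - 1‖)` have integrals proportional to `n ^ (-3 / 2)`. The exponent is below `1`, making the
singularity integrable, and above `1 / 2`, making the series converge. -/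
theorem ae_summable_inv_norm_fourier_sub_one :
    ∀ᵐ α : UnitAddCircle, (∀ n : ℕ, n ≠ 0 → (fourier n α : ℂ) ≠ 1) ∧
      Summable fun n : ℕ => (1 / ((n : ℝ) ^ 2 * ‖(fourier n α : ℂ) - 1‖)) ^ 2 := by
  set κ : UnitAddCircle → ℝ≥0∞ := fun y => (‖(fourier 1 y : ℂ) - 1‖ₑ⁻¹) ^ (3 / 4 : ℝ) with hκ
  have hκm : Measurable κ :=
    (((map_continuous (fourier 1)).measurable.sub_const 1).enorm.inv).pow_const _
  have htm : ∀ n : ℕ, Measurable fun α : UnitAddCircle =>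
      ENNReal.ofReal (1 / ((n + 1 : ℕ) : ℝ) ^ (3 / 2 : ℝ)) * κ ((n + 1) • α) := fun n =>
    (hκm.comp (measurePreserving_nsmul_addCircle n.succ_ne_zero).measurable).const_mul _
  have hsum : Summable fun n : ℕ => 1 / ((n + 1 : ℕ) : ℝ) ^ (3 / 2 : ℝ) :=
    (summable_nat_add_iff 1).2 (Real.summable_one_div_nat_rpow.2 (by norm_num))
  have hfin : ∫⁻ α : UnitAddCircle, ∑' n : ℕ,
      ENNReal.ofReal (1 / ((n + 1 : ℕ) : ℝ) ^ (3 / 2 : ℝ)) * κ ((n + 1) • α) ≠ ∞ := by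
    rw [lintegral_tsum fun n => (htm n).aemeasurable]
    have : ∀ n : ℕ, ∫⁻ α : UnitAddCircle,
        ENNReal.ofReal (1 / ((n + 1 : ℕ) : ℝ) ^ (3 / 2 : ℝ)) * κ ((n + 1) • α) =
        ENNReal.ofReal (1 / ((n + 1 : ℕ) : ℝ) ^ (3 / 2 : ℝ)) * ∫⁻ α, κ α := fun n => by
      rw [lintegral_const_mul' _ _ ENNReal.ofReal_ne_top,
        (measurePreserving_nsmul_addCircle n.succ_ne_zero).lintegral_comp hκm]
    simp only [this]
    rw [ENNReal.tsum_mul_right]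
    refine ENNReal.mul_ne_top ?_ lintegral_inv_norm_fourier_one_sub_one_ne_top
    rw [← ENNReal.ofReal_tsum_of_nonneg (fun n => by positivity) hsum]
    exact ENNReal.ofReal_ne_top
  filter_upwards [ae_lt_top (Measurable.tsum htm) hfin] with α hα
  have hne : ∀ n : ℕ, (fourier (n + 1 : ℕ) α : ℂ) ≠ 1 := by
    intro n hn
    -- A vanishing divisor would make a term of the finite sum infinite.
    have h1 := ENNReal.ne_top_of_tsum_ne_top hα.ne n
    refine h1 ?_
    have : κ ((n + 1) • α) = ∞ := by
      simp only [hκ]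
      rw [← fourier_eq_fourier_one_nsmul, hn]
      simp
    rw [this, ENNReal.mul_top]
    simp only [ne_eq, ENNReal.ofReal_eq_zero, not_le]
    positivity
  refine ⟨fun n hn => ?_, ?_⟩
  · obtain ⟨m, rfl⟩ := Nat.exists_eq_succ_of_ne_zero hn
    exact hne m
  · rw [← summable_nat_add_iff 1]
    set b : ℕ → ℝ := fun n => 1 / (((n + 1 : ℕ) : ℝ) ^ 2 * ‖(fourier (n + 1 : ℕ) α : ℂ) - 1‖)
      with hb
    have hd : ∀ n : ℕ, 0 < ‖(fourier (n + 1 : ℕ) α : ℂ) - 1‖ := fun n =>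
      norm_pos_iff.2 (sub_ne_zero.2 (hne n))
    have hb0 : ∀ n, 0 < b n := fun n => by have := hd n; simp only [hb]; positivity
    have hterm : ∀ n : ℕ, ENNReal.ofReal (1 / ((n + 1 : ℕ) : ℝ) ^ (3 / 2 : ℝ)) * κ ((n + 1) • α) =
        ENNReal.ofReal (b n ^ (3 / 4 : ℝ)) := by
      intro n
      simp only [hκ]
      rw [← fourier_eq_fourier_one_nsmul, ← ofReal_norm, ← ENNReal.ofReal_inv_of_pos (hd n),
        ENNReal.ofReal_rpow_of_pos (inv_pos.2 (hd n)), ← ENNReal.ofReal_mul (by positivity)]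
      congr 1
      simp only [hb]
      rw [one_div, one_div, mul_inv, Real.mul_rpow (by positivity) (by positivity)]
      congr 1
      rw [Real.inv_rpow (by positivity), ← Real.rpow_natCast, ← Real.rpow_mul (by positivity)]
      norm_num
    simp only [hterm] at hα
    have hs : Summable fun n => b n ^ (3 / 4 : ℝ) := by
      have := ENNReal.summable_toReal hα.ne
      refine this.congr fun n => ?_
      exact ENNReal.toReal_ofReal (Real.rpow_nonneg (hb0 n).le _)
    refine Summable.of_norm_bounded_eventually_nat hs ?_
    -- Eventually `b n ≤ 1`, so its square is at most its `3 / 4` power.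
    filter_upwards [hs.tendsto_atTop_zero.eventually (gt_mem_nhds one_pos)] with n hn
    have hb1 : b n ≤ 1 := by
      by_contra hcon
      exact absurd hn (not_lt.2 (Real.one_le_rpow (not_le.1 hcon).le (by norm_num)))
    have h2 : b n ^ 2 = b n ^ (2 : ℝ) := by norm_cast
    change ‖b n ^ 2‖ ≤ _
    rw [Real.norm_of_nonneg (by positivity), h2]
    exact Real.rpow_le_rpow_of_exponent_ge (hb0 n) hb1 (by norm_num)

end SmallDivisors

/-! ### Solving the cohomological equation over a rotation -/

section Cohomological

variable {L : ℝ} [hL : Fact (0 < L)]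

theorem ae_eq_of_fourierCoeff_eq {f g : AddCircle L → ℂ} (hf : MemLp f 2 haarAddCircle)
    (hg : MemLp g 2 haarAddCircle) (h : ∀ n, fourierCoeff f n = fourierCoeff g n) :
    f =ᵐ[haarAddCircle] g := by
  have : hf.toLp f = hg.toLp g := by
    apply fourierBasis.repr.injective
    ext n
    rw [fourierBasis_repr, fourierBasis_repr, fourierCoeff_congr_ae hf.coeFn_toLp,
      fourierCoeff_congr_ae hg.coeFn_toLp, h]
  exact (MemLp.toLp_eq_toLp_iff hf hg).1 this

theorem exists_memLp_fourierCoeff_eq {a : ℤ → ℂ} (ha : Summable fun n => ‖a n‖ ^ 2) :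
    ∃ g : AddCircle L → ℂ, MemLp g 2 haarAddCircle ∧ ∀ n, fourierCoeff g n = a n := by
  have hm : Memℓp a 2 := by
    refine memℓp_gen ?_
    simpa using ha
  refine ⟨fourierBasis.repr.symm ⟨a, hm⟩, Lp.memLp _, fun n => ?_⟩
  rw [← fourierBasis_repr, LinearIsometryEquiv.apply_symm_apply]

/-- The quotients `c n / (fourier n θ - 1)` are the coefficients of an L² function; uniqueness of
coefficients gives the equation almost everywhere, and its real part solves the real problem. -/
theorem exists_integrable_cobounding {F : AddCircle L → ℝ} (hF : Continuous F)
    (h0 : fourierCoeff (fun x => (F x : ℂ)) 0 = 0) {C : ℝ}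
    (hC : ∀ n : ℕ, n ≠ 0 → ‖fourierCoeff (fun x => (F x : ℂ)) n‖ ≤ C / (n : ℝ) ^ 2)
    {θ : AddCircle L} (hθ : ∀ n : ℕ, n ≠ 0 → (fourier n θ : ℂ) ≠ 1)
    (hs : Summable fun n : ℕ => (1 / ((n : ℝ) ^ 2 * ‖(fourier n θ : ℂ) - 1‖)) ^ 2) :
    ∃ G : AddCircle L → ℝ, Integrable G volume ∧ ∀ᵐ x, F x = G (x + θ) - G x := by
  set c := fourierCoeff (fun x => (F x : ℂ)) with hc
  set a : ℤ → ℂ := fun n => c n / (fourier n θ - 1) with ha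
  have haneg : ∀ n, ‖a (-n)‖ = ‖a n‖ := by
    intro n
    have : (fourier (-n) θ : ℂ) - 1 = conj (fourier n θ - 1) := by
      rw [fourier_neg, map_sub, map_one]
    simp only [ha]
    rw [this, hc, fourierCoeff_ofReal_neg, norm_div, norm_div, Complex.norm_conj,
      Complex.norm_conj]
  have hnat : Summable fun n : ℕ => ‖a n‖ ^ 2 := by
    refine Summable.of_nonneg_of_le (fun n => by positivity) (fun n => ?_) (hs.mul_left (C ^ 2))
    rcases eq_or_ne n 0 with rfl | hn
    · simp [ha, h0]
    · rw [← mul_pow]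
      gcongr
      simp only [ha]
      have hd : 0 < ‖(fourier n θ : ℂ) - 1‖ := norm_pos_iff.2 (sub_ne_zero.2 (hθ n hn))
      rw [norm_div, div_le_iff₀ hd]
      refine (hC n hn).trans (le_of_eq ?_)
      have : (0 : ℝ) < n := by positivity
      field_simp
  have hsum : Summable fun n : ℤ => ‖a n‖ ^ 2 :=
    Summable.of_nat_of_neg hnat (by simpa only [haneg] using hnat)
  obtain ⟨g, hg, hga⟩ := exists_memLp_fourierCoeff_eq (L := L) hsum
  have hgθ : MemLp (fun x => g (x + θ)) 2 haarAddCircle :=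
    hg.comp_measurePreserving (measurePreserving_add_right haarAddCircle θ)
  have hdiff : MemLp (fun x => g (x + θ) - g x) 2 haarAddCircle := hgθ.sub hg
  have hFL : MemLp (fun x => (F x : ℂ)) 2 haarAddCircle :=
    Continuous.memLp_of_hasCompactSupport (by fun_prop) (HasCompactSupport.of_compactSpace _)
  have hfne : ∀ n : ℤ, n ≠ 0 → (fourier n θ : ℂ) - 1 ≠ 0 := by
    intro n hn
    obtain ⟨m, rfl | rfl⟩ := n.eq_nat_or_neg
    · exact sub_ne_zero.2 (hθ m (by exact_mod_cast hn))
    · have h1 := sub_ne_zero.2 (hθ m (by rintro rfl; simp at hn))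
      have : (fourier (-(m : ℤ)) θ : ℂ) - 1 = conj (fourier m θ - 1) := by
        rw [fourier_neg, map_sub, map_one]
      rw [this]
      exact (map_ne_zero _).2 h1
  have hcoef : ∀ n, fourierCoeff (fun x => (F x : ℂ)) n =
      fourierCoeff (fun x => g (x + θ) - g x) n := by
    intro n
    have hneg : fourierCoeff (fun x => g (x + θ) - g x) n =
        fourierCoeff (fun x => g (x + θ)) n - fourierCoeff g n := by
      simp only [fourierCoeff, smul_sub]
      exact integral_sub ((hgθ.integrable one_le_two).fourier_smul _)
        ((hg.integrable one_le_two).fourier_smul _)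
    rw [hneg, fourierCoeff_comp_add_right, hga, ← hc]
    rcases eq_or_ne n 0 with rfl | hn
    · simp [h0]
    · have := hfne n hn
      simp only [ha]
      field_simp
  have hae := ae_eq_of_fourierCoeff_eq hFL hdiff hcoef
  refine ⟨fun x => (g x).re, ?_, ?_⟩
  · exact ((memLp_haarAddCircle_iff.1 hg).integrable one_le_two).re
  · have : (volume : Measure (AddCircle L)) ≪ haarAddCircle := by
      rw [volume_eq_smul_haarAddCircle]
      exact Measure.smul_absolutelyContinuous
    filter_upwards [this.ae_eq hae] with x hx
    have := congrArg Complex.re hx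
    simpa using this

end Cohomological

/-! ### Return to the parameter simplex -/

section Main

/-- For fixed `lB` the rotation number is a nonconstant affine function of `lA`, so null sets pull
back to null sets on slices, and Fubini applies. Normalising to the unit circle lets one null set
serve every circle length. -/
theorem ae_lengthSimplex_rotation_number {P : UnitAddCircle → Prop} (hP : ∀ᵐ α, P α) :
    ∀ᵐ p : LengthSimplex ∂lebSimplex, P (((1 - p.lA) / (1 + p.lB) : ℝ) : UnitAddCircle) := by
  set N := toMeasurable volume {α | ¬ P α} with hN
  have hNm : MeasurableSet N := measurableSet_toMeasurable _ _
  have hN0 : volume N = 0 := by rw [hN, measure_toMeasurable]; exact hP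
  have hNP : ∀ α, α ∉ N → P α := fun α h => by
    by_contra hcon
    exact h (subset_toMeasurable _ _ hcon)
  have hm : Measurable fun q : ℝ × ℝ => (((1 - q.2) / (1 + q.1) : ℝ) : UnitAddCircle) :=
    AddCircle.measurable_mk'.comp (by fun_prop)
  have hset : MeasurableSet {q : ℝ × ℝ | 0 < q.1 →
      (((1 - q.2) / (1 + q.1) : ℝ) : UnitAddCircle) ∉ N} :=
    MeasurableSet.imp (measurableSet_lt measurable_const measurable_fst) (hm hNm.compl)
  have hslice : ∀ b : ℝ, ∀ᵐ a : ℝ, 0 < b → (((1 - a) / (1 + b) : ℝ) : UnitAddCircle) ∉ N := by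
    intro b
    by_cases hb : 0 < b
    · have h1 : ∀ᵐ x : ℝ, ((x : ℝ) : UnitAddCircle) ∉ N :=
        (quasiMeasurePreserving_coe_addCircle 1).ae (measure_eq_zero_iff_ae_notMem.1 hN0)
      have h2 : ∀ᵐ x : ℝ, ((x * (1 + b)⁻¹ : ℝ) : UnitAddCircle) ∉ N := by
        have : volume ((fun x : ℝ => x * (1 + b)⁻¹) ⁻¹' {x : ℝ | ¬ (x : UnitAddCircle) ∉ N}) = 0 := by
          rw [Real.volume_preimage_mul_right (by positivity)]
          rw [show volume {x : ℝ | ¬ (x : UnitAddCircle) ∉ N} = 0 from h1, mul_zero]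
        exact this
      filter_upwards [(quasiMeasurePreserving_sub_left volume (1 : ℝ)).ae h2] with a ha _
      rwa [div_eq_mul_inv]
    · exact Eventually.of_forall fun a h => absurd h hb
  have hprod : ∀ᵐ q : ℝ × ℝ, 0 < q.1 → (((1 - q.2) / (1 + q.1) : ℝ) : UnitAddCircle) ∉ N :=
    (Measure.ae_prod_iff_ae_ae hset).2 (Eventually.of_forall hslice)
  have hswap : ∀ᵐ q : ℝ × ℝ, 0 < q.2 → (((1 - q.1) / (1 + q.2) : ℝ) : UnitAddCircle) ∉ N :=
    (Measure.measurePreserving_swap (μ := (volume : Measure ℝ))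
      (ν := (volume : Measure ℝ))).quasiMeasurePreserving.ae hprod
  have hopen : IsOpen {q : ℝ × ℝ | 0 < q.1 ∧ 0 < q.2 ∧ q.1 + q.2 < 1} :=
    (isOpen_lt continuous_const continuous_fst).inter
      ((isOpen_lt continuous_const continuous_snd).inter
        (isOpen_lt (continuous_fst.add continuous_snd) continuous_const))
  have hres := (measurePreserving_subtype_coe (μa := (volume : Measure (ℝ × ℝ)))
    hopen.measurableSet).quasiMeasurePreserving.ae (ae_restrict_of_ae hswap)
  filter_upwards [hres] with p hp
  exact hNP _ (hp p.lB_pos)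

theorem fourier_coe_div {L : ℝ} (n : ℤ) (θ : ℝ) :
    (fourier n ((θ / L : ℝ) : UnitAddCircle) : ℂ) = fourier n (θ : AddCircle L) := by
  rw [fourier_coe_apply, fourier_coe_apply]
  congr 1
  push_cast
  rw [div_one]
  ring

theorem isCoboundary_symIET (p : LengthSimplex) {f : ℝ → ℝ} {G : AddCircle (1 + p.lB) → ℝ}
    (hG : Integrable G volume)
    (hcob : ∀ᵐ x, circleExt (1 + p.lB) f x =
      G (x + ((1 - p.lA : ℝ) : AddCircle (1 + p.lB))) - G x) :
    IsCoboundary lebUnit (symIET p) (fun x => f x) := by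
  have hA := p.lA_pos
  have hB := p.lB_pos
  have hC := p.lC_pos
  have hsum := p.lA_add_lB_add_lC
  refine ⟨fun x => G ((x : ℝ) : AddCircle (1 + p.lB)), ?_, ?_⟩
  · have h1 : IntegrableOn (fun x : ℝ => G (x : AddCircle (1 + p.lB)))
        (Set.Ioc (-p.lB) (-p.lB + (1 + p.lB))) :=
      (AddCircle.measurePreserving_mk (1 + p.lB) (-p.lB)).integrable_comp_of_integrable hG
    have h2 : IntegrableOn (fun x : ℝ => G (x : AddCircle (1 + p.lB))) (Set.Ico 0 1) :=
      h1.mono_set fun x hx => ⟨by linarith [hx.1], by linarith [hx.2]⟩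
    exact measurePreserving_coe_lebUnit.integrable_comp_of_integrable h2
  · have hq := quasiMeasurePreserving_coe_lebUnit (1 + p.lB)
    have hcob' : ∀ᵐ x : AddCircle (1 + p.lB),
        circleExt (1 + p.lB) f (x + ((1 - p.lA : ℝ) : AddCircle (1 + p.lB))) =
        G (x + ((1 - p.lA : ℝ) : AddCircle (1 + p.lB)) +
          ((1 - p.lA : ℝ) : AddCircle (1 + p.lB))) -
        G (x + ((1 - p.lA : ℝ) : AddCircle (1 + p.lB))) :=
      (quasiMeasurePreserving_add_right volume _).ae hcob
    filter_upwards [hq.ae hcob, hq.ae hcob'] with x h1 h2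
    rw [circleExt_coe ⟨x.2.1, x.2.2.trans (by linarith)⟩,
      Set.indicator_of_mem (Set.mem_Iio.2 x.2.2)] at h1
    rcases coe_symIET_eq p f x with h | ⟨h, h0⟩
    · rw [h, h1]
    · rw [h0] at h2
      rw [h, h1]
      linarith

theorem theorem1p1 (f : ℝ → ℝ) (hf : IsC1AC f) (hf0 : f 0 = 0)
    (hf1 : Filter.Tendsto f (nhdsWithin 1 (Set.Iio 1)) (nhds 0))
    (hint : ∫ x in Set.Ico (0 : ℝ) 1, f x = 0) :
    (∀ᵐ p : LengthSimplex ∂lebSimplex,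
      IsCoboundary lebUnit (symIET p) (fun x => f x) ∧
      ¬ Ergodic (skewProduct (symIET p) (fun x => f x)) (lebUnit.prod volume)) ∧
    ((∃ x ∈ Set.Ico (0 : ℝ) 1, f x ≠ 0) →
      Dense {p : LengthSimplex |
        Ergodic (skewProduct (symIET p) (fun x => f x)) (lebUnit.prod volume)}) := by
  have hfc : ContinuousOn f (Set.Ico 0 1) := hf.1.continuousOn
  have hlt : ∀ p : LengthSimplex, 1 < 1 + p.lB ∧ 1 + p.lB ≤ 2 := fun p => by
    have := p.lA_pos
    have := p.lB_pos
    have := p.lC_pos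
    have := p.lA_add_lB_add_lC
    constructor <;> linarith
  refine ⟨?_, fun hne => ?_⟩
  · filter_upwards [ae_lengthSimplex_rotation_number ae_summable_inv_norm_fourier_sub_one]
      with p hp
    obtain ⟨hL1, hL2⟩ := hlt p
    simp only [fourier_coe_div] at hp
    obtain ⟨C, hC⟩ := exists_norm_fourierCoeff_circleExt_le hL1 hL2 hf hf0 hf1
    obtain ⟨G, hG, hcob⟩ := exists_integrable_cobounding (continuous_circleExt hL1 hfc hf0 hf1)
      (fourierCoeff_circleExt_zero hL1 hfc hf1 hint) hC hp.1 hp.2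
    have hcb := isCoboundary_symIET p hG hcob
    exact ⟨hcb, not_ergodic_skewProduct_of_isCoboundary
      (measurePreserving_symIET p).quasiMeasurePreserving hcb⟩
  · rw [dense_iff_inter_open]
    rintro U hU ⟨p, hp⟩
    obtain ⟨V, hV, rfl⟩ := isOpen_induced_iff.1 hU
    obtain ⟨hL1, hL2⟩ := hlt p
    obtain ⟨C, hC⟩ := exists_norm_fourierCoeff_circleExt_le hL1 hL2 hf hf0 hf1
    have hdec : Tendsto (fun n : ℕ =>
        n * ‖fourierCoeff (fun x => (circleExt (1 + p.lB) f x : ℂ)) n‖) atTop (𝓝 0) := by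
      refine squeeze_zero (fun n => by positivity) (fun n => ?_)
        (tendsto_const_div_atTop_nhds_zero_nat C)
      rcases eq_or_ne n 0 with rfl | hn
      · simp
      · have hn0 : (0 : ℝ) < n := by positivity
        calc (n : ℝ) * ‖fourierCoeff (fun x => (circleExt (1 + p.lB) f x : ℂ)) n‖
            ≤ n * (C / (n : ℝ) ^ 2) := by gcongr; exact hC n hn
          _ = C / n := by field_simp
    have hdense := dense_setOf_ergodic_rotation (continuous_circleExt hL1 hfc hf0 hf1)
      (fourierCoeff_circleExt_zero hL1 hfc hf1 hint) hdec
      (frequently_fourierCoeff_ne_zero (continuous_circleExt hL1 hfc hf0 hf1) hL1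
        (fun x hx => by
          rw [circleExt_coe ⟨zero_le_one.trans hx.1.le, hx.2⟩,
            Set.indicator_of_notMem (Set.notMem_Iio.2 hx.1.le)])
        (by
          obtain ⟨x, hx, hfx⟩ := hne
          refine ⟨((x : ℝ) : AddCircle (1 + p.lB)), ?_⟩
          rwa [circleExt_coe ⟨hx.1, hx.2.trans hL1⟩, Set.indicator_of_mem (Set.mem_Iio.2 hx.2)]))
    -- Only `lA = 1 - θ` moves: with `lB` fixed, the circle and the extension stay the same, and
    -- density of angles on the line suffices.
    have hcont : Continuous fun θ : ℝ => ((1 - θ, p.lB) : ℝ × ℝ) := by fun_prop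
    have hopen : IsOpen {q : ℝ × ℝ | 0 < q.1 ∧ 0 < q.2 ∧ q.1 + q.2 < 1} :=
      (isOpen_lt continuous_const continuous_fst).inter
        ((isOpen_lt continuous_const continuous_snd).inter
          (isOpen_lt (continuous_fst.add continuous_snd) continuous_const))
    obtain ⟨θ, hθ, herg⟩ := hdense.inter_open_nonempty _ ((hV.inter hopen).preimage hcont)
      ⟨1 - p.lA, by
        have : ((1 - (1 - p.lA), p.lB) : ℝ × ℝ) = p.1 := by
          rw [_root_.sub_sub_cancel]; rfl
        rw [Set.mem_preimage, this]
        exact ⟨hp, p.2⟩⟩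
    refine ⟨⟨(1 - θ, p.lB), hθ.2⟩, hθ.1, ?_⟩
    refine ergodic_skewProduct_symIET _ hfc ?_
    have h1 : 1 - LengthSimplex.lA ⟨(1 - θ, p.lB), hθ.2⟩ = θ := _root_.sub_sub_cancel 1 θ
    rw [h1]
    exact herg

end Main
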